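/- Let $\pi_\theta$ be a strictly positive differentiable probability density on $\mathbb{R}^d$, let $M$ be a symmetric positive definite $d\times d$ matrix, and let $\varepsilon>0$. Let $\pi(\theta,p)=\pi_\theta(\theta)\,N(p;0,M)$, where $N(\cdot\,;0,M)$ is the density of the centred Gaussian with covariance $M$; write $\pi$ also for the probability measure on $\mathbb{R}^d\times\mathbb{R}^d$ with this density. Let $F:(\theta_0,p_0)\mapsto(\theta_1,p_1)$ be the leap-frog map $$p_{1/2}=p_0+\tfrac{\varepsilon}{2}\nabla\log\pi_\theta(\theta_0),\qquad \theta_1=\theta_0+\varepsilon M^{-1}p_{1/2},\qquad p_1=p_{1/2}+\tfrac{\varepsilon}{2}\nabla\log\pi_\theta(\theta_1),$$ which is a bijection of $\mathbb{R}^d\times\mathbb{R}^d$, so that $F^k$ is defined for all $k\in\mathbb{Z}$. Let $K\ge 1$. The Calderhead–Bernton et al. multi-proposal algorithm generates random vectors $z^{(i)}=(z^{(i)}_0,z^{(i)}_1,\dots,z^{(i)}_K)$, $i\ge1$, of states $z^{(i)}_k=(\theta^{(i)}_k,p^{(i)}_k)$ in the following way. Given $z^{(1)},\dots,z^{(i)}$,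 with $x=z_0^{(i)}$: 1. Draw $L$ uniformly from $\{0,1,\dots,K\}$. Put $\ell=K-L$ if $K-L\ge L$, and $\ell=-L$ otherwise. 2. Let $z_0^{(i+1)}=F^{\ell}(x)$ with probability $\min\{1,\pi(F^{\ell}(x))/\pi(x)\}$, and $z_0^{(i+1)}=x$ otherwise. 3. Replace the momentum component of $z_0^{(i+1)}$ by a fresh draw from $N(0,M)$. 4. Let $\mathcal A=\{F^k(x): k=-L,\dots,K-L\}$. Conditionally on $x$ and $L$, draw $z_1^{(i+1)},\dots,z_K^{(i+1)}$ independently of each other and of steps 2–3, each equal to $y\in\mathcal A$ with probability $\pi(y)/\sum_{y'\in\mathcal A}\pi(y')$. Let $P_0$ be the transition kernel of the Markov chain $(z_0^{(i)})_{i\ge1}$ defined by steps 1–3. Suppose that $P_0$ is uniquely ergodic, that is, it has exactly one stationary probability measure, and that the law of $z_0^{(1)}$ is absolutely continuous with respect to $\pi$. Then, almost surely, $$\frac1{NK}\sum_{i=1}^N\sum_{k=1}^K\delta_{z_k^{(i)}}\;\xrightarrow{\ w\ }\;\pi\qquad\text{as }N\to\infty,$$ where $\xrightarrow{\ w\ }$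 denotes weak convergence of measures. -/

import Mathlib

open MeasureTheory ProbabilityTheory Filter Topology
open scoped ENNReal NNReal Matrix Gradient

noncomputable section

/-- The augmented phase space of positions `θ` and momenta `p`. -/
abbrev Phase (d : ℕ) : Type :=
  EuclideanSpace ℝ (Fin d) × EuclideanSpace ℝ (Fin d)

/-- The inputs of Hamiltonian Monte Carlo: a positive differentiable probability density `pdf`
for the parameter `θ`, a mass matrix `M`, and a leap-frog step size `ε`. -/
structure HMCInput (d : ℕ) where
  pdf : EuclideanSpace ℝ (Fin d) → ℝ
  pdf_pos : ∀ θ, 0 < pdf θ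
  pdf_differentiable : Differentiable ℝ pdf
  integral_pdf : ∫ θ, pdf θ = 1
  M : Matrix (Fin d) (Fin d) ℝ
  M_posDef : M.PosDef
  ε : ℝ
  ε_pos : 0 < ε

/-- The Lebesgue density of the centred Gaussian `N(0, M)`. -/
def gaussianDensity {d : ℕ} (M : Matrix (Fin d) (Fin d) ℝ) (p : EuclideanSpace ℝ (Fin d)) : ℝ :=
  (√((2 * Real.pi) ^ d * M.det))⁻¹ * Real.exp (-(p.ofLp ⬝ᵥ (M⁻¹ *ᵥ p.ofLp)) / 2)

theorem gaussianDensity_pos {d : ℕ} {M : Matrix (Fin d) (Fin d) ℝ} (hM : M.PosDef)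
    (p : EuclideanSpace ℝ (Fin d)) : 0 < gaussianDensity M p := by
  have := hM.det_pos
  unfold gaussianDensity
  positivity

theorem continuous_gaussianDensity {d : ℕ} (M : Matrix (Fin d) (Fin d) ℝ) :
    Continuous (gaussianDensity M) := by
  unfold gaussianDensity
  fun_prop

open scoped MatrixOrder in
theorem lintegral_gaussianDensity {d : ℕ} {M : Matrix (Fin d) (Fin d) ℝ} (hM : M.PosDef) :
    ∫⁻ p, ENNReal.ofReal (gaussianDensity M p) = 1 := by
  have hMi : (M⁻¹).PosDef := hM.inv
  have hdet := hM.det_pos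
  set S : Matrix (Fin d) (Fin d) ℝ := CFC.sqrt M⁻¹ with hS
  have hSS : S * S = M⁻¹ := CFC.sqrt_mul_sqrt_self _ hMi.posSemidef.nonneg
  have hSH : Sᵀ = S := by
    have h : S.PosSemidef := Matrix.nonneg_iff_posSemidef.1 (CFC.sqrt_nonneg M⁻¹)
    simpa [Matrix.conjTranspose_eq_transpose_of_trivial] using h.isHermitian.eq
  have hd2 : S.det * S.det = (M.det)⁻¹ := by
    rw [← Matrix.det_mul, hSS, Matrix.det_nonsing_inv, Ring.inverse_eq_inv']
  have hd0 : S.det ≠ 0 := by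
    intro h
    rw [h, zero_mul] at hd2
    exact (inv_pos.2 hdet).ne hd2
  let f : EuclideanSpace ℝ (Fin d) →ₗ[ℝ] EuclideanSpace ℝ (Fin d) := S.toLpLin 2 2
  have hf : LinearMap.det f ≠ 0 := by
    rw [LinearMap.det_toLpLin]; exact hd0
  have hq : ∀ p : EuclideanSpace ℝ (Fin d), p.ofLp ⬝ᵥ (M⁻¹ *ᵥ p.ofLp) = ‖f p‖ ^ 2 := by
    intro p
    have : ‖f p‖ ^ 2 = (S *ᵥ p.ofLp) ⬝ᵥ (S *ᵥ p.ofLp) := by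
      rw [EuclideanSpace.norm_sq_eq]
      simp [f, dotProduct, pow_two, Matrix.toLpLin_apply]
    rw [this, ← hSS, ← Matrix.mulVec_mulVec, Matrix.dotProduct_mulVec, ← Matrix.mulVec_transpose,
      hSH]
  have hG : ∫⁻ v : EuclideanSpace ℝ (Fin d), ENNReal.ofReal (Real.exp (-(1 / 2) * ‖v‖ ^ 2))
      = ENNReal.ofReal (√((2 * Real.pi) ^ d)) := by
    have h := GaussianFourier.integral_rexp_neg_mul_sq_norm (V := EuclideanSpace ℝ (Fin d))
      (b := 1 / 2) (by norm_num)
    have hpos : (0 : ℝ) < (Real.pi / (1 / 2)) ^ (Module.finrank ℝ (EuclideanSpace ℝ (Fin d)) / 2 : ℝ) := by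
      positivity
    rw [← ofReal_integral_eq_lintegral_ofReal _ (ae_of_all _ fun v => (Real.exp_pos _).le), h]
    · congr 1
      rw [Real.sqrt_eq_rpow, ← Real.rpow_natCast, ← Real.rpow_mul (by positivity)]
      rw [finrank_euclideanSpace, Fintype.card_fin]
      congr 1 <;> ring
    · by_contra hni
      rw [integral_undef hni] at h
      exact hpos.ne h
  have hmf : Measurable f := f.continuous_of_finiteDimensional.measurable
  have hcomp : ∫⁻ p, ENNReal.ofReal (Real.exp (-(1 / 2) * ‖f p‖ ^ 2))
      = ENNReal.ofReal |(S.det)⁻¹| * ENNReal.ofReal (√((2 * Real.pi) ^ d)) := by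
    rw [← hG, ← lintegral_map (μ := volume) (g := f)
      (f := fun v => ENNReal.ofReal (Real.exp (-(1 / 2) * ‖v‖ ^ 2))) (by fun_prop) hmf,
      Measure.map_linearMap_addHaar_eq_smul_addHaar _ hf, lintegral_smul_measure,
      LinearMap.det_toLpLin, smul_eq_mul]
  have hint : ∀ p : EuclideanSpace ℝ (Fin d), ENNReal.ofReal (gaussianDensity M p)
      = ENNReal.ofReal ((√((2 * Real.pi) ^ d * M.det))⁻¹)
        * ENNReal.ofReal (Real.exp (-(1 / 2) * ‖f p‖ ^ 2)) := by
    intro p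
    rw [← ENNReal.ofReal_mul (by positivity), gaussianDensity, hq]
    congr 3
    ring
  simp_rw [hint]
  rw [lintegral_const_mul _ (by fun_prop), hcomp, ← ENNReal.ofReal_mul (by positivity),
    ← ENNReal.ofReal_mul (by positivity), ← ENNReal.ofReal_one]
  congr 1
  have h1 : |(S.det)⁻¹| = √M.det := by
    rw [eq_comm, Real.sqrt_eq_iff_mul_self_eq hdet.le (abs_nonneg _), abs_mul_abs_self, ← mul_inv,
      hd2, inv_inv]
  rw [h1, Real.sqrt_mul (by positivity)]
  have h2 : √M.det ≠ 0 := (Real.sqrt_pos.2 hdet).ne'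
  have h3 : √((2 * Real.pi) ^ d) ≠ 0 := (Real.sqrt_pos.2 (by positivity)).ne'
  field_simp

namespace HMCInput

variable {d : ℕ} (H : HMCInput d)

theorem measurable_pdf : Measurable H.pdf := H.pdf_differentiable.continuous.measurable

theorem lintegral_pdf : ∫⁻ θ, ENNReal.ofReal (H.pdf θ) = 1 := by
  have hi : Integrable H.pdf := by
    by_contra h
    have := H.integral_pdf
    rw [integral_undef h] at this
    exact zero_ne_one this
  rw [← ofReal_integral_eq_lintegral_ofReal hi (ae_of_all _ fun θ => (H.pdf_pos θ).le),
    H.integral_pdf, ENNReal.ofReal_one]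

/-- The density `π(θ, p) = π_θ(θ) N(p; 0, M)` of the augmented target. -/
def density (z : Phase d) : ℝ := H.pdf z.1 * gaussianDensity H.M z.2

theorem density_pos (z : Phase d) : 0 < H.density z :=
  mul_pos (H.pdf_pos _) (gaussianDensity_pos H.M_posDef _)

theorem measurable_density : Measurable H.density :=
  (H.measurable_pdf.comp measurable_fst).mul
    ((continuous_gaussianDensity H.M).measurable.comp measurable_snd)

/-- The law `N(0, M)` of a fresh momentum. -/
def momentumLaw : Measure (EuclideanSpace ℝ (Fin d)) :=
  volume.withDensity fun p => ENNReal.ofReal (gaussianDensity H.M p)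

instance : IsProbabilityMeasure H.momentumLaw :=
  ⟨by rw [momentumLaw, withDensity_apply _ .univ, setLIntegral_univ,
    lintegral_gaussianDensity H.M_posDef]⟩

/-- The augmented target distribution `π`. -/
def target : ProbabilityMeasure (Phase d) :=
  ⟨volume.withDensity fun z => ENNReal.ofReal (H.density z), by
    constructor
    rw [withDensity_apply _ .univ, setLIntegral_univ]
    have h1 : Measurable fun θ => ENNReal.ofReal (H.pdf θ) := H.measurable_pdf.ennreal_ofReal
    have h2 : Measurable fun p => ENNReal.ofReal (gaussianDensity H.M p) :=
      (continuous_gaussianDensity H.M).measurable.ennreal_ofReal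
    simp only [density, ENNReal.ofReal_mul (H.pdf_pos _).le]
    rw [Measure.volume_eq_prod, lintegral_prod_mul h1.aemeasurable h2.aemeasurable,
      H.lintegral_pdf, lintegral_gaussianDensity H.M_posDef, one_mul]⟩

/-- The force `∇ log π_θ`. -/
def score (θ : EuclideanSpace ℝ (Fin d)) : EuclideanSpace ℝ (Fin d) :=
  gradient (fun θ' => Real.log (H.pdf θ')) θ

/-- The velocity `M⁻¹ p`. -/
def velocity (p : EuclideanSpace ℝ (Fin d)) : EuclideanSpace ℝ (Fin d) :=
  WithLp.toLp 2 (H.M⁻¹ *ᵥ p.ofLp)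

theorem measurable_score : Measurable H.score := by
  unfold score gradient
  exact (LinearIsometryEquiv.continuous _).measurable.comp (measurable_fderiv ℝ _)

theorem measurable_velocity : Measurable H.velocity := by
  unfold velocity
  exact Continuous.measurable (by fun_prop)

/-- One leap-frog step `(θ₀, p₀) ↦ (θ₁, p₁)`, with half step momentum `p_{1/2}`. -/
def leapfrogStep (z : Phase d) : Phase d :=
  let pHalf := z.2 + (H.ε / 2) • H.score z.1
  let θ₁ := z.1 + H.ε • H.velocity pHalf
  (θ₁, pHalf + (H.ε / 2) • H.score θ₁)

/-- The leap-frog step traversed backwards. -/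
def leapfrogBack (z : Phase d) : Phase d :=
  let pHalf := z.2 - (H.ε / 2) • H.score z.1
  let θ₀ := z.1 - H.ε • H.velocity pHalf
  (θ₀, pHalf - (H.ε / 2) • H.score θ₀)

/-- The leap-frog map `F` as a permutation of the phase space, so that `F ^ k` makes sense for all
integers `k`. -/
def leapfrog : Equiv.Perm (Phase d) where
  toFun := H.leapfrogStep
  invFun := H.leapfrogBack
  left_inv z := by simp [leapfrogStep, leapfrogBack]
  right_inv z := by simp [leapfrogStep, leapfrogBack]

theorem measurable_leapfrog_zpow (k : ℤ) : Measurable ⇑(H.leapfrog ^ k) := by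
  have hs := H.measurable_score
  have hv := H.measurable_velocity
  have h1 : Measurable H.leapfrogStep := by unfold leapfrogStep; fun_prop
  have h2 : Measurable H.leapfrogBack := by unfold leapfrogBack; fun_prop
  induction k with
  | zero => simpa using measurable_id
  | succ n ih =>
    rw [zpow_add_one, Equiv.Perm.coe_mul]
    exact ih.comp h1
  | pred n ih =>
    rw [zpow_sub_one, Equiv.Perm.coe_mul]
    exact ih.comp h2

/-- The signed number `ℓ` of leap-frog steps proposed when `L` has been drawn. -/
def jump (K L : ℕ) : ℤ := if (L : ℤ) ≤ (K : ℤ) - L then (K : ℤ) - L else -(L : ℤ)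

/-- The probability of accepting `F ^ ℓ` applied to `z`. -/
def acceptProb (ℓ : ℤ) (z : Phase d) : ℝ :=
  min 1 (H.density ((H.leapfrog ^ ℓ) z) / H.density z)

theorem measurable_acceptProb (ℓ : ℤ) : Measurable (H.acceptProb ℓ) :=
  measurable_const.min
    ((H.measurable_density.comp (H.measurable_leapfrog_zpow ℓ)).div H.measurable_density)

theorem acceptProb_nonneg (ℓ : ℤ) (z : Phase d) : 0 ≤ H.acceptProb ℓ z :=
  le_min zero_le_one (div_pos (H.density_pos _) (H.density_pos _)).le

/-- Keep the position of `z` and draw a new momentum from `N(0, M)`. -/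
def refreshLaw (z : Phase d) : Measure (Phase d) := (Measure.dirac z.1).prod H.momentumLaw

instance (z : Phase d) : IsProbabilityMeasure (H.refreshLaw z) := by
  unfold refreshLaw; infer_instance

theorem measurable_refreshLaw : Measurable H.refreshLaw := by
  have h : H.refreshLaw = fun z => H.momentumLaw.map (Prod.mk z.1) := by
    funext z
    rw [refreshLaw, Measure.dirac_prod]
  rw [h]
  refine Measure.measurable_of_measurable_coe _ fun s hs => ?_
  simp_rw [Measure.map_apply measurable_prodMk_left hs]
  exact (measurable_measure_prodMk_left hs).comp measurable_fst

/-- Given `L` and the current state `z`, the law of the next chain state: move to `F ^ ℓ z` or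
stay at `z`, then refresh the momentum. -/
def moveLaw (K L : ℕ) (z : Phase d) : Measure (Phase d) :=
  ENNReal.ofReal (H.acceptProb (jump K L) z) • H.refreshLaw ((H.leapfrog ^ jump K L) z)
    + ENNReal.ofReal (1 - H.acceptProb (jump K L) z) • H.refreshLaw z

instance (K L : ℕ) (z : Phase d) : IsProbabilityMeasure (H.moveLaw K L z) := by
  constructor
  have h0 := H.acceptProb_nonneg (jump K L) z
  have h1 : H.acceptProb (jump K L) z ≤ 1 := min_le_left _ _
  simp only [moveLaw, Measure.add_apply, Measure.smul_apply, measure_univ, smul_eq_mul, mul_one]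
  rw [← ENNReal.ofReal_add h0 (by linarith)]
  simp

theorem measurable_moveLaw (K L : ℕ) : Measurable (H.moveLaw K L) := by
  refine Measure.measurable_of_measurable_coe _ fun s hs => ?_
  have hr : Measurable fun z => H.refreshLaw z s :=
    (Measure.measurable_coe hs).comp H.measurable_refreshLaw
  have ha := H.measurable_acceptProb (jump K L)
  simp only [moveLaw, Measure.add_apply, Measure.smul_apply, smul_eq_mul]
  exact (ha.ennreal_ofReal.mul (hr.comp (H.measurable_leapfrog_zpow _))).add
    ((measurable_const.sub ha).ennreal_ofReal.mul hr)

open Classical in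
/-- The collection `A(z, L)` of the states `F ^ k z` with `-L ≤ k ≤ K - L`. -/
def proposalSet (K L : ℕ) (z : Phase d) : Finset (Phase d) :=
  (Finset.Icc (-(L : ℤ)) ((K : ℤ) - L)).image fun k => (H.leapfrog ^ k) z

/-- The weight of the state `y` in the collection `A(z, L)`. -/
def weight (K L : ℕ) (z y : Phase d) : ℝ :=
  H.density y / ∑ y' ∈ H.proposalSet K L z, H.density y'

/-- The law of one recycled state given `L` and the current state `z`. -/
def selectLaw (K L : ℕ) (z : Phase d) : Measure (Phase d) :=
  ∑ y ∈ H.proposalSet K L z, ENNReal.ofReal (H.weight K L z y) • Measure.dirac y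

theorem proposalSet_nonempty (K L : ℕ) (z : Phase d) : (H.proposalSet K L z).Nonempty := by
  classical
  refine Finset.Nonempty.image ?_ _
  rw [Finset.nonempty_Icc]
  omega

instance (K L : ℕ) (z : Phase d) : IsProbabilityMeasure (H.selectLaw K L z) := by
  constructor
  have hs : 0 < ∑ y' ∈ H.proposalSet K L z, H.density y' :=
    Finset.sum_pos (fun y _ => H.density_pos y) (H.proposalSet_nonempty K L z)
  simp only [selectLaw, Measure.finsetSum_apply, Measure.smul_apply, measure_univ, smul_eq_mul,
    mul_one]
  simp only [weight]
  rw [← ENNReal.ofReal_sum_of_nonneg fun y _ => (div_pos (H.density_pos y) hs).le, ← Finset.sum_div, div_self hs.ne', ENNReal.ofReal_one]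

/-- Sums over the finite set of visited states depend measurably on the starting point. -/
theorem measurable_sum_proposalSet (K L : ℕ) {g : Phase d × Phase d → ℝ≥0∞} (hg : Measurable g) :
    Measurable fun z => ∑ y ∈ H.proposalSet K L z, g (z, y) := by
  classical
  set s : Finset ℤ := Finset.Icc (-(L : ℤ)) ((K : ℤ) - L)
  -- Each visited state is counted at its first visit.
  have key : ∀ z, ∑ y ∈ H.proposalSet K L z, g (z, y) =
      ∑ k ∈ s, if ∀ j ∈ s, j < k → (H.leapfrog ^ j) z ≠ (H.leapfrog ^ k) z
        then g (z, (H.leapfrog ^ k) z) else 0 := by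
    intro z
    rw [← Finset.sum_filter]
    have himg : H.proposalSet K L z =
        (s.filter fun k => ∀ j ∈ s, j < k → (H.leapfrog ^ j) z ≠ (H.leapfrog ^ k) z).image
          fun k => (H.leapfrog ^ k) z := by
      ext y
      simp only [proposalSet, Finset.mem_image, Finset.mem_filter]
      constructor
      · rintro ⟨k, hk, rfl⟩
        let t := s.filter fun j => (H.leapfrog ^ j) z = (H.leapfrog ^ k) z
        have ht : t.Nonempty := ⟨k, Finset.mem_filter.2 ⟨hk, rfl⟩⟩
        have hm := Finset.mem_filter.1 (t.min'_mem ht)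
        refine ⟨t.min' ht, ⟨hm.1, fun j hj hlt heq => ?_⟩, hm.2⟩
        exact (not_le.2 hlt) (t.min'_le j (Finset.mem_filter.2 ⟨hj, heq.trans hm.2⟩))
      · rintro ⟨k, ⟨hk, -⟩, rfl⟩
        exact ⟨k, hk, rfl⟩
    rw [himg, Finset.sum_image]
    intro a ha b hb hab
    have ha' := Finset.mem_filter.1 ha
    have hb' := Finset.mem_filter.1 hb
    rcases lt_trichotomy a b with h | h | h
    · exact absurd hab (hb'.2 a ha'.1 h)
    · exact h
    · exact absurd hab.symm (ha'.2 b hb'.1 h)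
  simp_rw [key]
  refine Finset.measurable_fun_sum _ fun k _ => Measurable.ite ?_ ?_ measurable_const
  · have : {z | ∀ j ∈ s, j < k → (H.leapfrog ^ j) z ≠ (H.leapfrog ^ k) z} =
        ⋂ j ∈ s, ⋂ _ : j < k, {z | (H.leapfrog ^ j) z = (H.leapfrog ^ k) z}ᶜ := by
      ext z; simp
    rw [this]
    exact Finset.measurableSet_biInter _ fun j _ => MeasurableSet.iInter fun _ =>
      (measurableSet_eq_fun (H.measurable_leapfrog_zpow j) (H.measurable_leapfrog_zpow k)).compl
  · exact hg.comp (measurable_id.prodMk (H.measurable_leapfrog_zpow k))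

theorem measurable_selectLaw (K L : ℕ) : Measurable (H.selectLaw K L) := by
  have hW : Measurable fun z => ∑ y ∈ H.proposalSet K L z, ENNReal.ofReal (H.density y) :=
    H.measurable_sum_proposalSet K L (g := fun q => ENNReal.ofReal (H.density q.2))
      (H.measurable_density.comp measurable_snd).ennreal_ofReal
  refine Measure.measurable_of_measurable_coe _ fun A hA => ?_
  have key : ∀ z, H.selectLaw K L z A = ∑ y ∈ H.proposalSet K L z,
      ENNReal.ofReal (H.density y) / (∑ y' ∈ H.proposalSet K L z, ENNReal.ofReal (H.density y'))
        * A.indicator 1 y := by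
    intro z
    have hs : 0 < ∑ y' ∈ H.proposalSet K L z, H.density y' :=
      Finset.sum_pos (fun y _ => H.density_pos y) (H.proposalSet_nonempty K L z)
    simp only [selectLaw, Measure.finsetSum_apply, Measure.smul_apply, smul_eq_mul,
      Measure.dirac_apply' _ hA, weight]
    refine Finset.sum_congr rfl fun y _ => ?_
    rw [ENNReal.ofReal_div_of_pos hs, ENNReal.ofReal_sum_of_nonneg fun y _ => (H.density_pos y).le]
  simp_rw [key]
  refine H.measurable_sum_proposalSet K L (g := fun q => ENNReal.ofReal (H.density q.2) /
    (∑ y' ∈ H.proposalSet K L q.1, ENNReal.ofReal (H.density y')) * A.indicator 1 q.2) ?_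
  exact ((H.measurable_density.comp measurable_snd).ennreal_ofReal.div
    (hW.comp measurable_fst)).mul ((measurable_one.indicator hA).comp measurable_snd)

/-- Given the current state `z`, the joint law of the next chain state `z₀` and of the recycled
states `z₁, …, z_K`: `L` is uniform on `{0, …, K}`, and given `L` the states `z₀, z₁, …, z_K`
are independent. -/
def stepLaw (K : ℕ) (z : Phase d) : Measure (Phase d × (Fin K → Phase d)) :=
  ∑ L ∈ Finset.range (K + 1), ((K : ℝ≥0∞) + 1)⁻¹ •
    (H.moveLaw K L z).prod (Measure.pi fun _ : Fin K => H.selectLaw K L z)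

instance (K : ℕ) (z : Phase d) : IsProbabilityMeasure (H.stepLaw K z) := by
  constructor
  simp only [stepLaw, Measure.finsetSum_apply, Measure.smul_apply, measure_univ, smul_eq_mul,
    mul_one, Finset.sum_const, Finset.card_range, nsmul_eq_mul]
  push_cast
  exact ENNReal.mul_inv_cancel (by simp) (by finiteness)

theorem measurable_stepLaw (K : ℕ) : Measurable (H.stepLaw K) := by
  have hpi : ∀ L, Measurable fun z => Measure.pi fun _ : Fin K => H.selectLaw K L z := by
    intro L
    refine Measurable.measure_of_isPiSystem_of_isProbabilityMeasure generateFrom_pi.symm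
      isPiSystem_pi ?_
    rintro _ ⟨s, hs, rfl⟩
    simp_rw [Measure.pi_pi]
    have hs' : ∀ k, MeasurableSet (s k) := fun k => hs k (Set.mem_univ k)
    exact Finset.measurable_fun_prod _ fun k _ =>
      (Measure.measurable_coe (hs' k)).comp (H.measurable_selectLaw K L)
  refine Measure.measurable_of_measurable_coe _ fun s hs => ?_
  simp only [stepLaw, Measure.finsetSum_apply, Measure.smul_apply, smul_eq_mul]
  refine Finset.measurable_fun_sum _ fun L _ => Measurable.const_mul ?_ _
  have hprod : Measurable fun z =>
      (H.moveLaw K L z).prod (Measure.pi fun _ : Fin K => H.selectLaw K L z) := by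
    refine Measurable.measure_of_isPiSystem_of_isProbabilityMeasure generateFrom_prod.symm
      isPiSystem_prod ?_
    rintro _ ⟨a, ha, b, hb, rfl⟩
    have ha' : MeasurableSet a := ha
    have hb' : MeasurableSet b := hb
    simp_rw [Measure.prod_prod]
    exact ((Measure.measurable_coe ha').comp (H.measurable_moveLaw K L)).mul
      ((Measure.measurable_coe hb').comp (hpi L))
  exact (Measure.measurable_coe hs).comp hprod

/-- The transition kernel `z₀ ↦ (z₀*, (z₁*, …, z_K*))` of the algorithm. -/
def stepKernel (K : ℕ) : Kernel (Phase d) (Phase d × (Fin K → Phase d)) where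
  toFun := H.stepLaw K
  measurable' := H.measurable_stepLaw K

instance (K : ℕ) : IsMarkovKernel (H.stepKernel K) :=
  ⟨fun z => inferInstanceAs (IsProbabilityMeasure (H.stepLaw K z))⟩

/-- The transition kernel `P₀` of the chain `z₀ ↦ z₀*`. -/
def chainKernel (K : ℕ) : Kernel (Phase d) (Phase d) := (H.stepKernel K).fst

end HMCInput

/-- A transition kernel is uniquely ergodic if it has exactly one stationary probability
measure. -/
def UniquelyErgodic {E : Type*} [MeasurableSpace E] (κ : Kernel E E) : Prop :=
  ∃! μ : ProbabilityMeasure E, κ.Invariant (μ : Measure E)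

/-- A sequence of random variables `Z 0, Z 1, …` with `Z i = (z₀, (z₁, …, z_K))` is generated by the
algorithm: given the whole history `Z 0, …, Z i`, the next vector `Z (i + 1)` is drawn from the
transition kernel at the chain component `z₀` of `Z i`. -/
def IsCalderheadBerntonChain {d : ℕ} (H : HMCInput d) (K : ℕ) {Ω : Type*} [MeasurableSpace Ω]
    (P : Measure Ω) (Z : ℕ → Ω → Phase d × (Fin K → Phase d)) : Prop :=
  ∀ i, HasCondDistrib (Z (i + 1)) (fun ω (j : Fin (i + 1)) => Z j ω)
    ((H.stepKernel K).comap (fun h : Fin (i + 1) → Phase d × (Fin K → Phase d) =>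
      (h (Fin.last i)).1) (by fun_prop)) P

/-- The averaged empirical measure `(N K)⁻¹ ∑ᵢ ∑ₖ δ_{zₖ⁽ⁱ⁾}` of the recycled states in the first `N`
vectors of a sequence. -/
def recycledEmpiricalMeasure {d K : ℕ} (z : ℕ → Phase d × (Fin K → Phase d)) (N : ℕ) :
    FiniteMeasure (Phase d) :=
  ((N : ℝ≥0) * (K : ℝ≥0))⁻¹ •
    ∑ i ∈ Finset.range N, ∑ k : Fin K, (diracProba ((z i).2 k)).toFiniteMeasure

end

/-! The proof combines a strong law of large numbers for the chain of whole vectors with an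
invariance identity for the recycled states.

Law of large numbers. Let `μ` be the only stationary law of a kernel `κ`, let `f` have negative
mean, and let `A` be the set of paths along which the maximal partial sums of `f` tend to infinity.
`A` is shift invariant, so the probability `h w` of `A` for the chain started at `w` is harmonic. A
bounded harmonic function satisfies `E (h X₀ - h X₁)² = 0` under the stationary chain, so `h μ` is
again an invariant measure, and by uniqueness `h μ = c μ`. Since `h μ` is the law of the initial
state on `A`, the integral of `f (x 0)` over `A` is `c ∫ f dμ`. The maximal ergodic theorem makes it
nonnegative, which forces `c = 0`: `A` is null for every initial law that is absolutely continuous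
with respect to `μ`. Applying this to `f` and `-f`, each centred slightly above its mean, gives
convergence of averages (`ae_tendsto_average`). Ergodicity of the shift is never needed.

Invariance. The leap-frog map is a composition of shears, hence preserves Lebesgue measure, and
momentum reversal conjugates it to its inverse. Metropolis acceptance of the flipped proposal is
therefore reversible, and the refreshment hides the flip (`lintegral_moveLaw_target`). For the
recycled states, the uniform position of the window is what preserves `π`
(`sum_lintegral_windowAverage`): if the window has no repetitions, a change of variables along the
orbit turns the sum over positions into the normalising weight; otherwise the window is a whole
cycle, whatever its position.

The vector chain inherits unique ergodicity from `P₀`, because its kernel reads only the chain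
component. The law of large numbers for a countable convergence-determining family of open sets then
gives almost sure weak convergence. -/

noncomputable section

/-! ### Maximal ergodic theorem -/

section MaximalSums

variable {α : Type*} {T : α → α} {φ : α → ℝ}

/-- The maximum of the Birkhoff sums of `φ` of length at most `n`. -/
def maxBirkhoffSum (T : α → α) (φ : α → ℝ) : ℕ → α → ℝ
  | 0, _ => 0
  | n + 1, x => max 0 (φ x + maxBirkhoffSum T φ n (T x))

/-- The set of points with unbounded Birkhoff sums. -/
def divergenceSet (T : α → α) (φ : α → ℝ) : Set α :=
  {x | Tendsto (fun n => maxBirkhoffSum T φ n x) atTop atTop}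

theorem maxBirkhoffSum_nonneg (n : ℕ) (x : α) : 0 ≤ maxBirkhoffSum T φ n x := by
  cases n with
  | zero => exact le_rfl
  | succ n => exact le_max_left _ _

theorem birkhoffSum_le_maxBirkhoffSum (n : ℕ) (x : α) :
    birkhoffSum T φ n x ≤ maxBirkhoffSum T φ n x := by
  induction n generalizing x with
  | zero => simp [maxBirkhoffSum]
  | succ n ih =>
    rw [birkhoffSum_succ']
    exact le_max_of_le_right (by gcongr; exact ih _)

theorem monotone_maxBirkhoffSum (x : α) : Monotone fun n => maxBirkhoffSum T φ n x := by
  refine monotone_nat_of_le_succ fun n => ?_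
  induction n generalizing x with
  | zero => exact maxBirkhoffSum_nonneg _ _
  | succ n ih => exact max_le_max le_rfl (by gcongr; exact ih _)

/-- The maximal sums increase with their length, so they either diverge or converge, and a limit
bounds all Birkhoff sums. -/
theorem exists_birkhoffSum_le_of_notMem_divergenceSet {x : α} (hx : x ∉ divergenceSet T φ) :
    ∃ C, ∀ n, birkhoffSum T φ n x ≤ C := by
  rcases tendsto_atTop_of_monotone (monotone_maxBirkhoffSum (T := T) (φ := φ) x) with h | ⟨l, hl⟩
  · exact absurd h hx
  · exact ⟨l, fun n => (birkhoffSum_le_maxBirkhoffSum n x).trans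
      ((monotone_maxBirkhoffSum x).ge_of_tendsto hl n)⟩

/-- The maximal sum of length `n + 1` at `x` and that of length `n` at `T x` differ by at most a
quantity independent of `n`, so they diverge together. -/
theorem preimage_divergenceSet : T ⁻¹' divergenceSet T φ = divergenceSet T φ := by
  ext x
  simp only [divergenceSet, Set.mem_preimage, Set.mem_ofPred_eq]
  rw [← tendsto_add_atTop_iff_nat (f := fun n => maxBirkhoffSum T φ n x) 1]
  constructor
  · intro h
    exact tendsto_atTop_mono (fun n => le_max_right _ _) (tendsto_atTop_add_const_left _ (φ x) h)
  · intro h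
    refine tendsto_atTop_mono (fun n => ?_) (tendsto_atTop_add_const_left _ (-|φ x|) h)
    have h0 := maxBirkhoffSum_nonneg (T := T) (φ := φ) n (T x)
    have : maxBirkhoffSum T φ (n + 1) x ≤ |φ x| + maxBirkhoffSum T φ n (T x) :=
      max_le (by positivity) (by gcongr; exact le_abs_self _)
    linarith

variable [MeasurableSpace α]

theorem measurable_maxBirkhoffSum (hT : Measurable T) (hφ : Measurable φ) (n : ℕ) :
    Measurable (maxBirkhoffSum T φ n) := by
  induction n with
  | zero => exact measurable_const
  | succ n ih => exact measurable_const.max (hφ.add (ih.comp hT))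

theorem measurableSet_divergenceSet (hT : Measurable T) (hφ : Measurable φ) :
    MeasurableSet (divergenceSet T φ) :=
  measurableSet_tendsto _ fun n => measurable_maxBirkhoffSum hT hφ n

theorem integrable_maxBirkhoffSum {μ : Measure α} (hT : MeasurePreserving T μ μ)
    (hφ : Integrable φ μ) (n : ℕ) : Integrable (maxBirkhoffSum T φ n) μ := by
  induction n with
  | zero => exact integrable_zero _ _ _
  | succ n ih => exact (integrable_zero _ _ _).sup (hφ.add (hT.integrable_comp_of_integrable ih))

/-- A form of the maximal ergodic theorem. -/
theorem setIntegral_divergenceSet_nonneg {μ : Measure α} (hT : MeasurePreserving T μ μ)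
    (hm : Measurable φ) (hφ : Integrable φ μ) : 0 ≤ ∫ x in divergenceSet T φ, φ x ∂μ := by
  set A := divergenceSet T φ with hA
  have hAm : MeasurableSet A := measurableSet_divergenceSet hT.measurable hm
  have hTA : MeasurePreserving T (μ.restrict A) (μ.restrict A) := by
    have := hT.restrict_preimage hAm
    rwa [hA, preimage_divergenceSet] at this
  have hM : ∀ n, Integrable (maxBirkhoffSum T φ n) (μ.restrict A) := fun n =>
    (integrable_maxBirkhoffSum hT hφ n).restrict
  have hMT : ∀ n, Integrable (fun x => maxBirkhoffSum T φ n (T x)) (μ.restrict A) := fun n =>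
    hTA.integrable_comp_of_integrable (hM n)
  -- The integrand equals `max (-maxBirkhoffSum T φ n (T x)) (φ x)`: it is dominated by `|φ x|`, and
  -- on `A` it equals `φ x` from some `n` on.
  have hlim : Tendsto (fun n => ∫ x in A,
      (maxBirkhoffSum T φ (n + 1) x - maxBirkhoffSum T φ n (T x)) ∂μ) atTop
      (𝓝 (∫ x in A, φ x ∂μ)) := by
    refine tendsto_integral_of_dominated_convergence (fun x => |φ x|)
      (fun n => ((hM _).sub (hMT n)).aestronglyMeasurable) hφ.abs.restrict
      (fun n => ae_of_all _ fun x => ?_) ((ae_restrict_iff' hAm).2 (ae_of_all _ fun x hx => ?_))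
    · have h0 := maxBirkhoffSum_nonneg (T := T) (φ := φ) n (T x)
      rw [Real.norm_eq_abs, maxBirkhoffSum]
      rcases max_cases 0 (φ x + maxBirkhoffSum T φ n (T x)) with h | h <;> rw [h.1]
      · rw [zero_sub, abs_neg, abs_of_nonneg h0]
        exact le_trans (by linarith [h.2]) (neg_le_abs (φ x))
      · simp
    · have hTx : T x ∈ A := by
        rw [← Set.mem_preimage, hA, preimage_divergenceSet]; exact hx
      refine tendsto_const_nhds.congr' ?_
      filter_upwards [(tendsto_atTop.1 hTx) (-φ x)] with n hn
      rw [maxBirkhoffSum, max_eq_right (by linarith)]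
      ring
  refine ge_of_tendsto' hlim fun n => ?_
  rw [integral_sub (hM _) (hMT n), sub_nonneg]
  -- Invariance of `A` and of `μ` removes `T`; what remains is the integral of an increment of a
  -- monotone sequence.
  have : ∫ x in A, maxBirkhoffSum T φ n (T x) ∂μ = ∫ x in A, maxBirkhoffSum T φ n x ∂μ := by
    rw [← integral_map hTA.aemeasurable (by rw [hTA.map_eq]; exact (hM n).aestronglyMeasurable),
      hTA.map_eq]
  rw [this]
  exact integral_mono (hM n) (hM _) fun x => monotone_maxBirkhoffSum x n.le_succ

end MaximalSums

/-! ### Path laws of Markov chains -/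

section MarkovPaths

open Preorder

variable {E : Type*}

/-- Extend a history by one more state. -/
def snocHistory (n : ℕ) (p : (Finset.Iic n → E) × E) : Finset.Iic (n + 1) → E :=
  fun i => if h : (i : ℕ) ≤ n then p.1 ⟨i, Finset.mem_Iic.2 h⟩ else p.2

theorem snocHistory_frestrictLe (n : ℕ) (x : ℕ → E) :
    snocHistory n (frestrictLe (π := fun _ => E) n x, x (n + 1)) = frestrictLe (n + 1) x := by
  funext i
  unfold snocHistory
  split_ifs with h
  · rfl
  · have : (i : ℕ) = n + 1 := le_antisymm (Finset.mem_Iic.1 i.2) (by omega)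
    simp [frestrictLe, this]

variable [MeasurableSpace E]

theorem measurable_snocHistory (n : ℕ) : Measurable (snocHistory (E := E) n) := by
  refine measurable_pi_lambda _ fun i => ?_
  unfold snocHistory
  split_ifs <;> fun_prop

/-- The transition kernel of a homogeneous Markov chain, as a kernel on its histories. -/
def historyKernel (κ : Kernel E E) (n : ℕ) : Kernel (Finset.Iic n → E) E :=
  κ.comap (fun h => h ⟨n, Finset.mem_Iic.2 le_rfl⟩) (by fun_prop)

instance (κ : Kernel E E) [IsMarkovKernel κ] (n : ℕ) : IsMarkovKernel (historyKernel κ n) := by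
  unfold historyKernel; infer_instance

/-- A law on the space of sequences which is the law of a Markov chain with transition kernel
`κ`. -/
def IsMarkovPathLaw (κ : Kernel E E) (Q : Measure (ℕ → E)) : Prop :=
  ∀ n, Q.map (fun x => (frestrictLe (π := fun _ => E) n x, x (n + 1))) =
    Q.map (frestrictLe n) ⊗ₘ historyKernel κ n

/-- The law of a Markov chain is determined by its initial law and its transition kernel. -/
theorem IsMarkovPathLaw.ext {κ : Kernel E E} [IsMarkovKernel κ] {Q Q' : Measure (ℕ → E)}
    [IsFiniteMeasure Q] [IsFiniteMeasure Q']
    (hQ : IsMarkovPathLaw κ Q) (hQ' : IsMarkovPathLaw κ Q')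
    (h0 : Q.map (fun x => x 0) = Q'.map (fun x => x 0)) : Q = Q' := by
  have key : ∀ n, Q.map (frestrictLe (π := fun _ => E) n) = Q'.map (frestrictLe n) := by
    intro n
    induction n with
    | zero =>
      let e : E → (Finset.Iic 0 → E) := fun w _ => w
      have he : Measurable e := by fun_prop
      have hcomp : frestrictLe (π := fun _ => E) 0 = e ∘ fun x => x 0 := by
        funext x i
        have : (i : ℕ) = 0 := Nat.le_zero.1 (Finset.mem_Iic.1 i.2)
        simp [e, frestrictLe, this]
      rw [hcomp, ← Measure.map_map he (by fun_prop), h0, Measure.map_map he (by fun_prop)]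
    | succ n ih =>
      have hcomp : frestrictLe (π := fun _ => E) (n + 1) =
          snocHistory n ∘ fun x => (frestrictLe (π := fun _ => E) n x, x (n + 1)) := by
        funext x; exact (snocHistory_frestrictLe n x).symm
      rw [hcomp, ← Measure.map_map (measurable_snocHistory n) (by fun_prop),
        ← Measure.map_map (measurable_snocHistory n) (by fun_prop), hQ n, hQ' n, ih]
  -- Every finite set of times lies in an initial segment, so the laws of the histories determine
  -- all finite dimensional laws.
  refine IsProjectiveLimit.unique (P := fun I => Q'.map I.restrict) (fun I => ?_) fun _ => rfl
  have hI : I ⊆ Finset.Iic (I.sup id) := fun i hi => Finset.mem_Iic.2 (Finset.le_sup (f := id) hi)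
  have hcomp : I.restrict (π := fun _ => E) =
    Finset.restrict₂ (π := fun _ => E) hI ∘ frestrictLe (π := fun _ => E) (I.sup id) := rfl
  have hm : Measurable (Finset.restrict₂ (π := fun _ => E) hI) := Finset.measurable_restrict₂ hI
  change Q.map I.restrict = Q'.map I.restrict
  rw [hcomp, ← Measure.map_map hm (by fun_prop), ← Measure.map_map hm (by fun_prop), key]

/-- Forget the first state of a sequence. -/
def pathShift (x : ℕ → E) : ℕ → E := fun n => x (n + 1)

theorem measurable_pathShift : Measurable (pathShift (E := E)) := by
  unfold pathShift; fun_prop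

/-- The kernel reads only the last state of a history, so the conditional law given the full history
is also the one given the history without its first state. -/
theorem IsMarkovPathLaw.pathShift {κ : Kernel E E} [IsMarkovKernel κ] {Q : Measure (ℕ → E)}
    [IsFiniteMeasure Q] (hQ : IsMarkovPathLaw κ Q) : IsMarkovPathLaw κ (Q.map pathShift) := by
  intro n
  let g : (Finset.Iic (n + 1) → E) → (Finset.Iic n → E) := fun h i =>
    h ⟨i + 1, Finset.mem_Iic.2 (by have := Finset.mem_Iic.1 i.2; omega)⟩
  have hg : Measurable g := by fun_prop
  have h1 : HasCondDistrib (fun x : ℕ → E => x (n + 1 + 1)) (frestrictLe (π := fun _ => E) (n + 1))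
      ((historyKernel κ n).comap g hg) Q := by
    refine ⟨by fun_prop, ?_⟩
    rw [hQ (n + 1)]
    rfl
  have h2 := h1.comp_right.map_eq
  rw [Measure.map_map (by fun_prop) measurable_pathShift,
    Measure.map_map (by fun_prop) measurable_pathShift]
  exact h2

variable (κ : Kernel E E) [IsMarkovKernel κ]

/-- The law of the Markov chain started at a given state. -/
def pathKernel : Kernel E (ℕ → E) :=
  (Kernel.traj (X := fun _ => E) (historyKernel κ) 0).comap (fun w _ => w) (by fun_prop)

instance : IsMarkovKernel (pathKernel κ) := by unfold pathKernel; infer_instance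

theorem isMarkovPathLaw_pathKernel_comp (μ : Measure E) [IsProbabilityMeasure μ] :
    IsMarkovPathLaw κ (pathKernel κ ∘ₘ μ) := by
  have : pathKernel κ ∘ₘ μ = Kernel.trajMeasure (X := fun _ => E) μ (historyKernel κ) := by
    rw [Kernel.trajMeasure, pathKernel]
    ext s hs
    rw [Measure.bind_apply hs (Kernel.aemeasurable _), Measure.bind_apply hs (Kernel.aemeasurable _),
      lintegral_map (Kernel.measurable_coe _ hs) (by fun_prop)]
    rfl
  rw [this]
  intro n
  exact (Kernel.map_frestrictLe_trajMeasure_compProd_eq_map_trajMeasure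
    (X := fun _ => E) (κ := historyKernel κ)).symm

theorem isMarkovPathLaw_pathKernel (w : E) : IsMarkovPathLaw κ (pathKernel κ w) := by
  have := isMarkovPathLaw_pathKernel_comp κ (Measure.dirac w)
  rwa [Measure.dirac_bind (Kernel.measurable _)] at this

theorem map_eval_zero_pathKernel (w : E) :
    (pathKernel κ w).map (fun x => x 0) = Measure.dirac w := by
  have h := Kernel.traj_map_frestrictLe_apply (X := fun _ => E) (κ := historyKernel κ) 0 0
    (fun _ => w)
  rw [Kernel.partialTraj_self, Kernel.id_apply] at h
  have hcomp : (fun x : ℕ → E => x 0) =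
    (fun y : Finset.Iic 0 → E => y ⟨0, Finset.mem_Iic.2 le_rfl⟩) ∘ frestrictLe (π := fun _ => E) 0 :=
    rfl
  rw [hcomp, ← Measure.map_map (by fun_prop) (by fun_prop), pathKernel, Kernel.comap_apply, h,
    Measure.map_dirac' (by fun_prop)]

/-- The path starts at `w` almost surely, so the event on its initial state has probability zero or
one. -/
theorem pathKernel_eval_zero_inter (w : E) {B : Set E} (hB : MeasurableSet B) (A : Set (ℕ → E)) :
    pathKernel κ w ((fun x => x 0) ⁻¹' B ∩ A) = B.indicator (fun w => pathKernel κ w A) w := by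
  have hB' : MeasurableSet ((fun x : ℕ → E => x 0) ⁻¹' B) := hB.preimage (by fun_prop)
  have h : pathKernel κ w ((fun x => x 0) ⁻¹' B) = B.indicator 1 w := by
    rw [← Measure.map_apply (by fun_prop) hB, map_eval_zero_pathKernel, Measure.dirac_apply' _ hB]
  by_cases hw : w ∈ B
  · rw [Set.indicator_of_mem hw (fun w => pathKernel κ w A)]
    rw [Set.indicator_of_mem hw, Pi.one_apply] at h
    rw [← prob_compl_eq_zero_iff hB'] at h
    exact Measure.measure_inter_eq_of_ae
      ((measure_eq_zero_iff_ae_notMem.1 h).mono fun x hx => by simpa using hx)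
  · rw [Set.indicator_of_notMem hw] at h ⊢
    exact measure_mono_null Set.inter_subset_left h

theorem map_eval_zero_pathKernel_comp (μ : Measure E) :
    (pathKernel κ ∘ₘ μ).map (fun x => x 0) = μ := by
  rw [Measure.map_comp _ _ (by fun_prop)]
  have : (pathKernel κ).map (fun x => x 0) = Kernel.id := by
    ext w : 1
    rw [Kernel.map_apply _ (by fun_prop), map_eval_zero_pathKernel, Kernel.id_apply]
  rw [this, Measure.id_comp]

/-- The law of a Markov chain is the mixture of the laws with deterministic initial state. -/
theorem IsMarkovPathLaw.eq_pathKernel_comp {κ : Kernel E E} [IsMarkovKernel κ]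
    {Q : Measure (ℕ → E)} [IsProbabilityMeasure Q] (hQ : IsMarkovPathLaw κ Q) :
    Q = pathKernel κ ∘ₘ Q.map (fun x => x 0) := by
  have : IsProbabilityMeasure (Q.map fun x => x 0) :=
    Measure.isProbabilityMeasure_map (measurable_pi_apply 0).aemeasurable
  refine hQ.ext (isMarkovPathLaw_pathKernel_comp κ _) ?_
  rw [map_eval_zero_pathKernel_comp]

theorem map_eval_one_pathKernel (w : E) : (pathKernel κ w).map (fun x => x 1) = κ w := by
  have h := Kernel.map_traj_succ_self (X := fun _ => E) (κ := historyKernel κ) (a := 0)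
  have h' := DFunLike.congr_fun h (fun _ => w)
  rw [Kernel.map_apply _ (by fun_prop)] at h'
  exact h'

/-- The Markov property at time one: the shifted path is again a chain with kernel `κ`, and its
initial law is `κ w`. -/
theorem map_pathShift_pathKernel (w : E) :
    (pathKernel κ w).map pathShift = pathKernel κ ∘ₘ κ w := by
  have : IsProbabilityMeasure ((pathKernel κ w).map pathShift) :=
    Measure.isProbabilityMeasure_map measurable_pathShift.aemeasurable
  rw [(isMarkovPathLaw_pathKernel κ w).pathShift.eq_pathKernel_comp,
    Measure.map_map (by fun_prop) measurable_pathShift]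
  congr 1
  exact map_eval_one_pathKernel κ w

theorem measurePreserving_pathShift {μ : Measure E} [IsProbabilityMeasure μ]
    (hμ : κ.Invariant μ) :
    MeasurePreserving pathShift (pathKernel κ ∘ₘ μ) (pathKernel κ ∘ₘ μ) := by
  refine ⟨measurable_pathShift, ?_⟩
  rw [Measure.map_comp _ _ measurable_pathShift]
  have : (pathKernel κ).map pathShift = pathKernel κ ∘ₖ κ := by
    ext w : 1
    rw [Kernel.map_apply _ measurable_pathShift, map_pathShift_pathKernel, Kernel.comp_apply]
  rw [this, ← Measure.comp_assoc, hμ.def]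

end MarkovPaths

/-! ### Strong law of large numbers under unique ergodicity -/

section LawOfLargeNumbers

variable {E : Type*}

theorem birkhoffSum_pathShift (f : E → ℝ) (n : ℕ) (x : ℕ → E) :
    birkhoffSum pathShift (fun y => f (y 0)) n x = ∑ i ∈ Finset.range n, f (x i) := by
  have : ∀ k (x : ℕ → E), (pathShift^[k] x) 0 = x k := by
    intro k
    induction k with
    | zero => intro x; rfl
    | succ k ih => intro x; rw [Function.iterate_succ_apply, ih]; rfl
  simp [birkhoffSum, this]

variable [MeasurableSpace E] {κ : Kernel E E} {μ : Measure E}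

theorem eq_smul_of_invariant
    (hu : ∀ ν : Measure E, IsProbabilityMeasure ν → κ.Invariant ν → ν = μ) {ν : Measure E}
    [IsFiniteMeasure ν] (hν : κ.Invariant ν) : ν = ν Set.univ • μ := by
  rcases eq_or_ne (ν Set.univ) 0 with h0 | h0
  · rw [h0, zero_smul]; exact Measure.measure_univ_eq_zero.1 h0
  have hp : IsProbabilityMeasure ((ν Set.univ)⁻¹ • ν) :=
    ⟨by simp [ENNReal.inv_mul_cancel h0 (measure_ne_top _ _)]⟩
  have hi : κ.Invariant ((ν Set.univ)⁻¹ • ν) := by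
    change ((ν Set.univ)⁻¹ • ν).bind κ = _
    rw [Measure.comp_smul, hν.def]
  rw [← hu _ hp hi, smul_smul, ENNReal.mul_inv_cancel h0 (measure_ne_top _ _), one_smul]

variable [IsMarkovKernel κ] [IsProbabilityMeasure μ]

theorem snd_compProd_of_invariant (hμ : κ.Invariant μ) : (μ ⊗ₘ κ).map Prod.snd = μ := by
  have := Measure.snd_compProd μ κ
  rwa [hμ.def] at this

/-- A bounded harmonic function is almost surely unchanged by one step of the stationary chain. -/
theorem harmonic_ae_eq (hμ : κ.Invariant μ) {h : E → ℝ} (hm : Measurable h)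
    (hb : ∀ w, |h w| ≤ 1) (hκ : ∀ w, ∫ w', h w' ∂κ w = h w) :
    ∀ᵐ p ∂(μ ⊗ₘ κ), h p.1 = h p.2 := by
  have hint : ∀ {g : E × E → ℝ}, Measurable g → (∀ p, |g p| ≤ 1) → Integrable g (μ ⊗ₘ κ) :=
    fun hg hb => Integrable.of_bound hg.aestronglyMeasurable 1 (ae_of_all _ hb)
  have hmul : ∀ a b : E, |h a * h b| ≤ 1 := fun a b => by
    rw [abs_mul]; exact mul_le_one₀ (hb a) (abs_nonneg _) (hb b)
  have i1 : Integrable (fun p : E × E => h p.1 * h p.1) (μ ⊗ₘ κ) :=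
    hint (by fun_prop) fun p => hmul _ _
  have i2 : Integrable (fun p : E × E => h p.1 * h p.2) (μ ⊗ₘ κ) :=
    hint (by fun_prop) fun p => hmul _ _
  have i3 : Integrable (fun p : E × E => h p.2 * h p.2) (μ ⊗ₘ κ) :=
    hint (by fun_prop) fun p => hmul _ _
  have e1 : ∫ p, h p.1 * h p.1 ∂(μ ⊗ₘ κ) = ∫ w, h w * h w ∂μ := by
    rw [Measure.integral_compProd i1]; simp
  have e2 : ∫ p, h p.1 * h p.2 ∂(μ ⊗ₘ κ) = ∫ w, h w * h w ∂μ := by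
    rw [Measure.integral_compProd i2]; simp [integral_const_mul, hκ]
  have e3 : ∫ p, h p.2 * h p.2 ∂(μ ⊗ₘ κ) = ∫ w, h w * h w ∂μ := by
    have := integral_map (μ := μ ⊗ₘ κ) measurable_snd.aemeasurable
      (f := fun w => h w * h w) (by fun_prop)
    rw [snd_compProd_of_invariant hμ] at this
    exact this.symm
  have i4 : Integrable (fun p : E × E => h p.1 * h p.1 - h p.1 * h p.2) (μ ⊗ₘ κ) := i1.sub i2
  have i5 : Integrable (fun p : E × E => h p.1 * h p.1 - h p.1 * h p.2 - h p.1 * h p.2)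
    (μ ⊗ₘ κ) := i4.sub i2
  -- Harmonicity evaluates the cross term and stationarity the second square; all three integrals
  -- agree, so the expanded square integrates to zero.
  have hz : ∫ p, (h p.1 - h p.2) ^ 2 ∂(μ ⊗ₘ κ) = 0 := by
    have : ∀ p : E × E, (h p.1 - h p.2) ^ 2 =
        h p.1 * h p.1 - h p.1 * h p.2 - h p.1 * h p.2 + h p.2 * h p.2 := fun p => by ring
    simp_rw [this]
    rw [integral_add i5 i3, integral_sub i4 i2, integral_sub i1 i2,
      e1, e2, e3]
    ring
  have hi : Integrable (fun p : E × E => (h p.1 - h p.2) ^ 2) (μ ⊗ₘ κ) := by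
    have : (fun p : E × E => (h p.1 - h p.2) ^ 2) = fun p =>
        h p.1 * h p.1 - h p.1 * h p.2 - h p.1 * h p.2 + h p.2 * h p.2 := by funext p; ring
    rw [this]
    exact i5.add i3
  filter_upwards [(integral_eq_zero_iff_of_nonneg (fun p => sq_nonneg _) hi).1 hz] with p hp
  exact sub_eq_zero.1 (pow_eq_zero_iff two_ne_zero |>.1 hp)

/-- A bounded harmonic function is the density of an invariant measure. -/
theorem invariant_withDensity_of_harmonic (hμ : κ.Invariant μ) {h : E → ℝ≥0∞} (hm : Measurable h)
    (hb : ∀ w, h w ≤ 1) (hκ : ∀ w, ∫⁻ w', h w' ∂κ w = h w) :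
    κ.Invariant (μ.withDensity h) := by
  have hfin : ∀ w, h w ≠ ∞ := fun w => ne_top_of_le_ne_top ENNReal.one_ne_top (hb w)
  have hae : ∀ᵐ p ∂(μ ⊗ₘ κ), (h p.1).toReal = (h p.2).toReal := by
    refine harmonic_ae_eq hμ hm.ennreal_toReal (fun w => ?_) fun w => ?_
    · rw [abs_of_nonneg ENNReal.toReal_nonneg]
      exact ENNReal.toReal_le_of_le_ofReal zero_le_one (by simpa using hb w)
    · rw [integral_toReal hm.aemeasurable (ae_of_all _ fun w => (hfin w).lt_top), hκ]
  change (μ.withDensity h).bind κ = μ.withDensity h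
  ext B hB
  have hκB := κ.measurable_coe hB
  rw [Measure.bind_apply hB κ.aemeasurable, lintegral_withDensity_eq_lintegral_mul _ hm hκB,
    withDensity_apply _ hB]
  -- Under the stationary two-step law, `h` at the current state may be replaced by `h` at the next
  -- one, whose marginal is `μ`.
  calc ∫⁻ w, h w * κ w B ∂μ
      = ∫⁻ p, h p.1 * B.indicator 1 p.2 ∂(μ ⊗ₘ κ) := by
        rw [Measure.lintegral_compProd (by fun_prop)]
        refine lintegral_congr fun w => ?_
        change h w * κ w B = ∫⁻ b, h w * B.indicator 1 b ∂κ w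
        rw [lintegral_const_mul _ (by fun_prop), lintegral_indicator_one hB]
    _ = ∫⁻ p, h p.2 * B.indicator 1 p.2 ∂(μ ⊗ₘ κ) := by
        refine lintegral_congr_ae (hae.mono fun p hp => ?_)
        simp only [(ENNReal.toReal_eq_toReal_iff' (hfin _) (hfin _)).1 hp]
    _ = ∫⁻ w, h w * B.indicator 1 w ∂((μ ⊗ₘ κ).map Prod.snd) := by
        rw [lintegral_map (by fun_prop) measurable_snd]
    _ = ∫⁻ w in B, h w ∂μ := by
        rw [snd_compProd_of_invariant hμ, ← lintegral_indicator hB]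
        refine lintegral_congr fun w => ?_
        by_cases hw : w ∈ B <;> simp [hw]

/-- The probability of divergence is harmonic because the divergence set is shift invariant;
uniqueness makes it a constant `c` almost everywhere. A positive `c` would make the integral of `φ`
over the divergence set negative, against the maximal ergodic theorem. -/
theorem pathKernel_divergenceSet_eq_zero (hμ : κ.Invariant μ)
    (hu : ∀ ν : Measure E, IsProbabilityMeasure ν → κ.Invariant ν → ν = μ)
    {f : E → ℝ} (hf : Measurable f) (hi : Integrable f μ) (hneg : ∫ w, f w ∂μ < 0) :
    ∀ᵐ w ∂μ, pathKernel κ w (divergenceSet pathShift fun x => f (x 0)) = 0 := by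
  set φ : (ℕ → E) → ℝ := fun x => f (x 0)
  set A := divergenceSet pathShift φ with hA
  set Q := pathKernel κ ∘ₘ μ
  have hφm : Measurable φ := by fun_prop
  have hAm : MeasurableSet A := measurableSet_divergenceSet measurable_pathShift hφm
  set h : E → ℝ≥0∞ := fun w => pathKernel κ w A
  have hm : Measurable h := Kernel.measurable_coe _ hAm
  have hharm : ∀ w, ∫⁻ w', h w' ∂κ w = h w := fun w => by
    have h1 := congrArg (fun m => m A) (map_pathShift_pathKernel κ w)
    simp only [Measure.map_apply measurable_pathShift hAm,
      Measure.bind_apply hAm (Kernel.aemeasurable _)] at h1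
    rw [hA, preimage_divergenceSet] at h1
    exact h1.symm
  have hν := invariant_withDensity_of_harmonic hμ hm (fun w => prob_le_one) hharm
  -- Restricting to `A` changes the initial law by the density `h`; this turns an integral over
  -- paths in `A` into one over `E`.
  have hlaw : (Q.restrict A).map (fun x => x 0) = μ.withDensity h := by
    ext B hB
    rw [Measure.map_apply (by fun_prop) hB, Measure.restrict_apply (hB.preimage (by fun_prop)),
      Measure.bind_apply ((hB.preimage (by fun_prop)).inter hAm) (Kernel.aemeasurable _),
      withDensity_apply _ hB, ← lintegral_indicator hB]
    exact lintegral_congr fun w => pathKernel_eval_zero_inter κ w hB A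
  have hfin : IsFiniteMeasure (μ.withDensity h) := by
    rw [← hlaw]; infer_instance
  have hsmul := eq_smul_of_invariant hu hν
  set c := μ.withDensity h Set.univ
  have hφi : Integrable φ Q := by
    have : Integrable f (Q.map fun x => x 0) := by rwa [map_eval_zero_pathKernel_comp]
    exact this.comp_measurable (by fun_prop)
  have hmain := setIntegral_divergenceSet_nonneg (measurePreserving_pathShift κ hμ) hφm hφi
  have hval : ∫ x in A, φ x ∂Q = c.toReal * ∫ w, f w ∂μ := by
    rw [← smul_eq_mul, ← integral_smul_measure, ← hsmul, ← hlaw,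
      integral_map (measurable_pi_apply 0).aemeasurable hf.aestronglyMeasurable]
  have hc : c = 0 := by
    by_contra hc
    have : 0 < c.toReal := ENNReal.toReal_pos hc (measure_ne_top _ _)
    rw [hval] at hmain
    nlinarith
  have h0 : μ.withDensity h = 0 := by rw [hsmul, hc, zero_smul]
  exact (withDensity_eq_zero_iff hm.aemeasurable).1 h0

/-- The sums of a function with negative mean along a uniquely ergodic chain are bounded above. -/
theorem ae_exists_sum_le (hμ : κ.Invariant μ)
    (hu : ∀ ν : Measure E, IsProbabilityMeasure ν → κ.Invariant ν → ν = μ)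
    {Q : Measure (ℕ → E)} [IsProbabilityMeasure Q] (hQ : IsMarkovPathLaw κ Q)
    (hQ0 : Q.map (fun x => x 0) ≪ μ)
    {f : E → ℝ} (hf : Measurable f) (hi : Integrable f μ) (hneg : ∫ w, f w ∂μ < 0) :
    ∀ᵐ x ∂Q, ∃ C, ∀ n, ∑ i ∈ Finset.range n, f (x i) ≤ C := by
  have hAm : MeasurableSet (divergenceSet pathShift fun x : ℕ → E => f (x 0)) :=
    measurableSet_divergenceSet measurable_pathShift (by fun_prop)
  have h0 : Q (divergenceSet pathShift fun x => f (x 0)) = 0 := by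
    rw [hQ.eq_pathKernel_comp, Measure.bind_apply hAm (Kernel.aemeasurable _),
      lintegral_eq_zero_iff (Kernel.measurable_coe _ hAm)]
    exact hQ0.ae_le (pathKernel_divergenceSet_eq_zero hμ hu hf hi hneg)
  filter_upwards [measure_eq_zero_iff_ae_notMem.1 h0] with x hx
  obtain ⟨C, hC⟩ := exists_birkhoffSum_le_of_notMem_divergenceSet hx
  exact ⟨C, fun n => by rw [← birkhoffSum_pathShift]; exact hC n⟩

/-- Subtracting the mean plus `1 / (k + 1)` from `f` leaves a negative mean, so the centred sums are
bounded above and their bound vanishes after division by `n`. Only countably many `k` are needed. -/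
theorem ae_eventually_average_lt (hμ : κ.Invariant μ)
    (hu : ∀ ν : Measure E, IsProbabilityMeasure ν → κ.Invariant ν → ν = μ)
    {Q : Measure (ℕ → E)} [IsProbabilityMeasure Q] (hQ : IsMarkovPathLaw κ Q)
    (hQ0 : Q.map (fun x => x 0) ≪ μ) {f : E → ℝ} (hf : Measurable f) (hi : Integrable f μ) :
    ∀ᵐ x ∂Q, ∀ r > ∫ w, f w ∂μ, ∀ᶠ n : ℕ in atTop,
      (n : ℝ)⁻¹ * ∑ i ∈ Finset.range n, f (x i) < r := by
  have key : ∀ k : ℕ, ∀ᵐ x ∂Q, ∃ C, ∀ n : ℕ,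
      ∑ i ∈ Finset.range n, (f (x i) - (∫ w, f w ∂μ + 1 / ((k : ℝ) + 1))) ≤ C := fun k => by
    refine ae_exists_sum_le hμ hu hQ hQ0 (hf.sub_const _) (hi.sub (integrable_const _)) ?_
    rw [integral_sub hi (integrable_const _)]
    simp
    positivity
  filter_upwards [ae_all_iff.2 key] with x hx r hr
  obtain ⟨k, hk⟩ := exists_nat_one_div_lt (sub_pos.2 hr)
  obtain ⟨C, hC⟩ := hx k
  have hlim : Tendsto (fun n : ℕ => (n : ℝ)⁻¹ * C) atTop (𝓝 0) := by
    simpa using tendsto_inv_atTop_nhds_zero_nat (𝕜 := ℝ) |>.mul_const C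
  have hpos : 0 < r - (∫ w, f w ∂μ + 1 / ((k : ℝ) + 1)) := by linarith
  filter_upwards [hlim.eventually_lt_const hpos, eventually_gt_atTop 0] with n hn hn0
  have h1 := hC n
  rw [Finset.sum_sub_distrib, Finset.sum_const, Finset.card_range, nsmul_eq_mul] at h1
  have hn' : (0 : ℝ) < n := by exact_mod_cast hn0
  rw [inv_mul_lt_iff₀ hn'] at hn ⊢
  linarith

/-- The strong law of large numbers for a uniquely ergodic Markov chain whose initial law is
absolutely continuous with respect to the stationary law. -/
theorem ae_tendsto_average (hμ : κ.Invariant μ)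
    (hu : ∀ ν : Measure E, IsProbabilityMeasure ν → κ.Invariant ν → ν = μ)
    {Q : Measure (ℕ → E)} [IsProbabilityMeasure Q] (hQ : IsMarkovPathLaw κ Q)
    (hQ0 : Q.map (fun x => x 0) ≪ μ) {f : E → ℝ} (hf : Measurable f) (hi : Integrable f μ) :
    ∀ᵐ x ∂Q, Tendsto (fun n : ℕ => (n : ℝ)⁻¹ * ∑ i ∈ Finset.range n, f (x i)) atTop
      (𝓝 (∫ w, f w ∂μ)) := by
  filter_upwards [ae_eventually_average_lt hμ hu hQ hQ0 hf hi,
    ae_eventually_average_lt hμ hu hQ hQ0 hf.neg hi.neg] with x h1 h2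
  refine tendsto_order.2 ⟨fun r hr => ?_, h1⟩
  have := h2 (-r) (by simpa [integral_neg] using hr)
  filter_upwards [this] with n hn
  simp only [Pi.neg_apply, Finset.sum_neg_distrib, mul_neg] at hn
  linarith

end LawOfLargeNumbers

/-! ### Averages over windows of an orbit -/

section OrbitWindows

variable {α : Type*} (F : Equiv.Perm α)

/-- The points which do not return to themselves in at most `K` steps. -/
def nonreturningSet (K : ℕ) : Set α := {z | ∀ j ∈ Finset.Icc 1 K, (F ^ (j : ℤ)) z ≠ z}

/-- The points of minimal period `n`. -/
def minimalPeriodSet (n : ℕ) : Set α :=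
  {z | (F ^ (n : ℤ)) z = z ∧ ∀ j ∈ Finset.Ico 1 n, (F ^ (j : ℤ)) z ≠ z}

variable {F}

theorem zpow_fixed_comp_iff (k j : ℤ) (z : α) :
    (F ^ j) ((F ^ k) z) = (F ^ k) z ↔ (F ^ j) z = z := by
  rw [← Equiv.Perm.mul_apply, ← zpow_add, add_comm, zpow_add, Equiv.Perm.mul_apply,
    (F ^ k).injective.eq_iff]

theorem zpow_mem_nonreturningSet_iff (K : ℕ) (k : ℤ) (z : α) :
    (F ^ k) z ∈ nonreturningSet F K ↔ z ∈ nonreturningSet F K := by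
  simp only [nonreturningSet, Set.mem_ofPred_eq, ne_eq, zpow_fixed_comp_iff]

theorem zpow_mem_minimalPeriodSet_iff (n : ℕ) (k : ℤ) (z : α) :
    (F ^ k) z ∈ minimalPeriodSet F n ↔ z ∈ minimalPeriodSet F n := by
  simp only [minimalPeriodSet, Set.mem_ofPred_eq, ne_eq, zpow_fixed_comp_iff]

theorem zpow_apply_eq_iff_sub (i j : ℤ) (z : α) :
    (F ^ i) z = (F ^ j) z ↔ (F ^ (j - i)) z = z := by
  rw [← zpow_fixed_comp_iff i, ← Equiv.Perm.mul_apply, ← zpow_add, sub_add_cancel, eq_comm]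

theorem nonreturningSet_injOn {K : ℕ} {z : α} (hz : z ∈ nonreturningSet F K) (a : ℤ) :
    Set.InjOn (fun b : ℕ => (F ^ ((b : ℤ) - a)) z) (Finset.range (K + 1)) := by
  have key : ∀ b c : ℕ, b < c → c < K + 1 → (F ^ ((b : ℤ) - a)) z ≠ (F ^ ((c : ℤ) - a)) z := by
    intro b c hbc hc h
    rw [zpow_apply_eq_iff_sub] at h
    refine hz (c - b) (Finset.mem_Icc.2 ⟨by omega, by omega⟩) ?_
    rw [Nat.cast_sub hbc.le]
    convert h using 3
    ring
  intro b hb c hc h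
  rcases lt_trichotomy b c with hlt | heq | hgt
  · exact absurd h (key b c hlt (by simpa using hc))
  · exact heq
  · exact absurd h.symm (key c b hgt (by simpa using hb))

theorem minimalPeriodSet_injOn {n : ℕ} {z : α} (hz : z ∈ minimalPeriodSet F n) :
    Set.InjOn (fun b : ℕ => (F ^ (b : ℤ)) z) (Finset.range n) := by
  have key : ∀ b c : ℕ, b < c → c < n → (F ^ (b : ℤ)) z ≠ (F ^ (c : ℤ)) z := by
    intro b c hbc hc h
    rw [zpow_apply_eq_iff_sub, ← Nat.cast_sub hbc.le] at h
    exact hz.2 (c - b) (Finset.mem_Ico.2 ⟨by omega, by omega⟩) h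
  intro b hb c hc h
  rcases lt_trichotomy b c with hlt | heq | hgt
  · exact absurd h (key b c hlt (by simpa using hc))
  · exact heq
  · exact absurd h.symm (key c b hgt (by simpa using hb))

/-- The least return time is the minimal period. -/
theorem compl_nonreturningSet (K : ℕ) :
    (nonreturningSet F K)ᶜ = ⋃ n ∈ Finset.Icc 1 K, minimalPeriodSet F n := by
  classical
  ext z
  simp only [Set.mem_compl_iff, Set.mem_iUnion, exists_prop]
  constructor
  · intro h
    have h' : ∃ j : ℕ, 1 ≤ j ∧ (F ^ (j : ℤ)) z = z ∧ j ≤ K := by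
      simp only [nonreturningSet, Set.mem_ofPred_eq, not_forall, not_not] at h
      obtain ⟨j, hj, hjz⟩ := h
      exact ⟨j, (Finset.mem_Icc.1 hj).1, hjz, (Finset.mem_Icc.1 hj).2⟩
    obtain ⟨h1, h2, h3⟩ := Nat.find_spec h'
    refine ⟨Nat.find h', Finset.mem_Icc.2 ⟨h1, h3⟩, h2, fun j hj hjz => ?_⟩
    rw [Finset.mem_Ico] at hj
    exact Nat.find_min h' hj.2 ⟨hj.1, hjz, hj.2.le.trans h3⟩
  · rintro ⟨n, hn, hz⟩ h
    exact h n hn hz.1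

theorem pairwiseDisjoint_minimalPeriodSet (K : ℕ) :
    Set.PairwiseDisjoint (Finset.Icc 1 K : Set ℕ) (minimalPeriodSet F) := by
  have key : ∀ m n, 1 ≤ m → m < n → Disjoint (minimalPeriodSet F m) (minimalPeriodSet F n) :=
    fun m n hm hmn => Set.disjoint_left.2 fun z hz hz' =>
      hz'.2 m (Finset.mem_Ico.2 ⟨hm, hmn⟩) hz.1
  intro m hm n hn hmn
  rw [Finset.mem_coe, Finset.mem_Icc] at hm hn
  rcases lt_or_gt_of_ne hmn with h | h
  · exact key m n hm.1 h
  · exact (key n m hn.1 h).symm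

variable (F) in
open Classical in
/-- The points visited between times `-a` and `K - a`. -/
def orbitWindow (K a : ℕ) (z : α) : Finset α :=
  (Finset.range (K + 1)).image fun b : ℕ => (F ^ ((b : ℤ) - a)) z

theorem sum_orbitWindow_of_nonreturning {K : ℕ} {z : α} (hz : z ∈ nonreturningSet F K) (a : ℕ)
    (g : α → ℝ≥0∞) : ∑ y ∈ orbitWindow F K a z, g y =
      ∑ b ∈ Finset.range (K + 1), g ((F ^ ((b : ℤ) - a)) z) := by
  classical
  rw [orbitWindow, Finset.sum_image (nonreturningSet_injOn hz a)]

theorem zpow_apply_emod {n : ℕ} {z : α} (hz : (F ^ (n : ℤ)) z = z) (k : ℤ) :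
    (F ^ (k % n)) z = (F ^ k) z := by
  conv_rhs => rw [← Int.emod_add_mul_ediv k n]
  rw [zpow_add, zpow_mul, Equiv.Perm.mul_apply,
    Equiv.Perm.zpow_apply_eq_self_of_apply_eq_self hz]

/-- As `n ≤ K`, the `K + 1` consecutive iterates in the window exhaust the cycle wherever the window
starts; a window is a set, so each point counts once. -/
theorem sum_orbitWindow_of_periodic {K n : ℕ} (hn : n ∈ Finset.Icc 1 K) {z : α}
    (hz : z ∈ minimalPeriodSet F n) (a : ℕ) (g : α → ℝ≥0∞) :
    ∑ y ∈ orbitWindow F K a z, g y = ∑ b ∈ Finset.range n, g ((F ^ (b : ℤ)) z) := by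
  classical
  rw [Finset.mem_Icc] at hn
  have hn0 : (0 : ℤ) < n := by omega
  rw [← Finset.sum_image (f := g) (minimalPeriodSet_injOn hz)]
  congr 1
  ext y
  simp only [orbitWindow, Finset.mem_image, Finset.mem_range]
  constructor
  · rintro ⟨b, -, rfl⟩
    have h0 := Int.emod_nonneg ((b : ℤ) - a) hn0.ne'
    have h1 := Int.emod_lt_of_pos ((b : ℤ) - a) hn0
    refine ⟨(((b : ℤ) - a) % n).toNat, by omega, ?_⟩
    rw [Int.toNat_of_nonneg h0, zpow_apply_emod hz.1]
  · rintro ⟨j, hj, rfl⟩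
    have h0 := Int.emod_nonneg ((j : ℤ) + a) hn0.ne'
    have h1 := Int.emod_lt_of_pos ((j : ℤ) + a) hn0
    -- The offset `a` is undone modulo the period; the remainder is below `n`, hence a valid index
    -- of the window.
    refine ⟨(((j : ℤ) + a) % n).toNat, by omega, ?_⟩
    rw [Int.toNat_of_nonneg h0, sub_eq_add_neg, add_comm, zpow_add, Equiv.Perm.mul_apply,
      zpow_apply_emod hz.1, ← Equiv.Perm.mul_apply, ← zpow_add]
    congr 2
    ring

/-- Advancing the starting point by one drops the first term and appends the value at `F ^ n`, which
is the same point. -/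
theorem sum_period_comp {n : ℕ} {z : α} (hz : (F ^ (n : ℤ)) z = z) (i : ℕ) (g : α → ℝ≥0∞) :
    ∑ b ∈ Finset.range n, g ((F ^ (b : ℤ)) ((F ^ (i : ℤ)) z)) =
      ∑ b ∈ Finset.range n, g ((F ^ (b : ℤ)) z) := by
  have one : ∀ w, (F ^ (n : ℤ)) w = w → ∑ b ∈ Finset.range n, g ((F ^ (b : ℤ)) (F w)) =
      ∑ b ∈ Finset.range n, g ((F ^ (b : ℤ)) w) := by
    intro w hw
    have hs : ∀ b : ℕ, (F ^ (b : ℤ)) (F w) = (F ^ ((b + 1 : ℕ) : ℤ)) w := fun b => by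
      rw [Nat.cast_succ, zpow_add_one, Equiv.Perm.mul_apply]
    simp_rw [hs]
    cases n with
    | zero => rfl
    | succ m => rw [Finset.sum_range_succ, Finset.sum_range_succ', hw]; simp
  induction i with
  | zero => simp
  | succ i ih =>
    have : (F ^ ((i + 1 : ℕ) : ℤ)) z = F ((F ^ (i : ℤ)) z) := by
      rw [Nat.cast_succ, add_comm, zpow_add, zpow_one, Equiv.Perm.mul_apply]
    rw [this, one _ ((zpow_fixed_comp_iff _ _ _).2 hz), ih]

variable [MeasurableSpace α] {μ : Measure α}

theorem setLIntegral_comp_zpow (hF : ∀ k : ℤ, MeasurePreserving ⇑(F ^ k) μ μ) {D : Set α}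
    (hD : MeasurableSet D) (hinv : ∀ (k : ℤ) z, (F ^ k) z ∈ D ↔ z ∈ D) (k : ℤ)
    {g : α → ℝ≥0∞} (hg : Measurable g) :
    ∫⁻ z in D, g ((F ^ k) z) ∂μ = ∫⁻ z in D, g z ∂μ := by
  have h := (hF k).setLIntegral_comp_preimage hD hg
  have hpre : ⇑(F ^ k) ⁻¹' D = D := by ext z; exact hinv k z
  rwa [hpre] at h

section Measurability

variable [MeasurableEq α]

theorem measurableSet_nonreturningSet (hF : ∀ k : ℤ, Measurable ⇑(F ^ k)) (K : ℕ) :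
    MeasurableSet (nonreturningSet F K) := by
  have : nonreturningSet F K = ⋂ j ∈ Finset.Icc 1 K, {z | (F ^ (j : ℤ)) z = z}ᶜ := by
    ext z; simp [nonreturningSet]
  rw [this]
  exact Finset.measurableSet_biInter _ fun j _ =>
    (measurableSet_eq_fun (hF j) measurable_id).compl

theorem measurableSet_minimalPeriodSet (hF : ∀ k : ℤ, Measurable ⇑(F ^ k)) (n : ℕ) :
    MeasurableSet (minimalPeriodSet F n) := by
  have : minimalPeriodSet F n =
      {z | (F ^ (n : ℤ)) z = z} ∩ ⋂ j ∈ Finset.Ico 1 n, {z | (F ^ (j : ℤ)) z = z}ᶜ := by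
    ext z; simp [minimalPeriodSet]
  rw [this]
  exact (measurableSet_eq_fun (hF n) measurable_id).inter
    (Finset.measurableSet_biInter _ fun j _ => (measurableSet_eq_fun (hF j) measurable_id).compl)

end Measurability

/-- The average of `f` over the points of a window, weighted by `p`. -/
def windowAverage (F : Equiv.Perm α) (p f : α → ℝ≥0∞) (K a : ℕ) (z : α) : ℝ≥0∞ :=
  ∑ y ∈ orbitWindow F K a z, p y / (∑ y' ∈ orbitWindow F K a z, p y') * f y

variable {p f : α → ℝ≥0∞}

/-- Without repetitions, both the window position `a` and the index `b` of the selected point range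
over `0, …, K`. Moving the selected point to the origin exchanges their roles, and the sum over `a`
then produces the normalising weight. -/
theorem sum_setLIntegral_windowAverage_of_nonreturning [MeasurableEq α]
    (hF : ∀ k : ℤ, MeasurePreserving ⇑(F ^ k) μ μ) (hp : Measurable p) (hf : Measurable f)
    (hp0 : ∀ z, p z ≠ 0) (hpt : ∀ z, p z ≠ ∞) (K : ℕ) :
    ∑ a ∈ Finset.range (K + 1), ∫⁻ z in nonreturningSet F K, p z * windowAverage F p f K a z ∂μ =
      (K + 1) * ∫⁻ z in nonreturningSet F K, p z * f z ∂μ := by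
  have hFm : ∀ k : ℤ, Measurable ⇑(F ^ k) := fun k => (hF k).measurable
  set C := nonreturningSet F K
  have hC : MeasurableSet C := measurableSet_nonreturningSet hFm K
  set W : ℕ → α → ℝ≥0∞ := fun a z => ∑ b ∈ Finset.range (K + 1), p ((F ^ ((b : ℤ) - a)) z)
  have hW : ∀ a, Measurable (W a) := fun a =>
    Finset.measurable_fun_sum _ fun b _ => hp.comp (hFm _)
  -- The window at position `a` around the moved point is the window at position `b` around `z`.
  have hWshift : ∀ (a b : ℕ) z, W a ((F ^ ((a : ℤ) - b)) z) = W b z := fun a b z => by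
    refine Finset.sum_congr rfl fun c _ => ?_
    rw [← Equiv.Perm.mul_apply, ← zpow_add]
    congr 3
    ring
  have hcancel : ∀ (a b : ℕ) z, (F ^ ((b : ℤ) - a)) ((F ^ ((a : ℤ) - b)) z) = z := fun a b z => by
    rw [← Equiv.Perm.mul_apply, ← zpow_add]
    simp
  have hW0 : ∀ a z, W a z ≠ 0 := fun a z h =>
    hp0 _ ((Finset.sum_eq_zero_iff.1 h) 0 (by simp))
  have hWt : ∀ a z, W a z ≠ ∞ := fun a z => ENNReal.sum_ne_top.2 fun b _ => hpt _
  have h1 : ∀ a, ∫⁻ z in C, p z * windowAverage F p f K a z ∂μ = ∑ b ∈ Finset.range (K + 1),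
      ∫⁻ z in C, p ((F ^ ((a : ℤ) - b)) z) * (p z / W b z * f z) ∂μ := by
    intro a
    have : ∀ z ∈ C, p z * windowAverage F p f K a z = ∑ b ∈ Finset.range (K + 1),
        p z * (p ((F ^ ((b : ℤ) - a)) z) / W a z * f ((F ^ ((b : ℤ) - a)) z)) := fun z hz => by
      rw [windowAverage, sum_orbitWindow_of_nonreturning hz, sum_orbitWindow_of_nonreturning hz,
        Finset.mul_sum]
    rw [setLIntegral_congr_fun hC this, lintegral_finsetSum]
    · refine Finset.sum_congr rfl fun b _ => ?_
      rw [← setLIntegral_comp_zpow hF hC (zpow_mem_nonreturningSet_iff K) ((a : ℤ) - b)]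
      · simp only [hcancel, hWshift]
      · exact hp.mul (((hp.comp (hFm _)).div (hW a)).mul (hf.comp (hFm _)))
    · exact fun b _ => hp.mul (((hp.comp (hFm _)).div (hW a)).mul (hf.comp (hFm _)))
  simp_rw [h1]
  rw [Finset.sum_comm]
  have h2 : ∀ b : ℕ, ∑ a ∈ Finset.range (K + 1),
      ∫⁻ z in C, p ((F ^ ((a : ℤ) - b)) z) * (p z / W b z * f z) ∂μ = ∫⁻ z in C, p z * f z ∂μ := by
    intro b
    rw [← lintegral_finsetSum
      (f := fun (a : ℕ) z => p ((F ^ ((a : ℤ) - b)) z) * (p z / W b z * f z)) _ fun a _ =>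
      (hp.comp (hFm _)).mul ((hp.div (hW b)).mul hf)]
    refine lintegral_congr fun z => ?_
    rw [← Finset.sum_mul]
    change W b z * _ = _
    rw [← mul_assoc, ENNReal.mul_div_cancel (hW0 b z) (hWt b z)]
  simp [h2]

/-- The window average is constant on each cycle and equals the `p`-weighted cycle mean of `f`, so
averaging the integral over the cycle gives the identity for every single position `a`. -/
theorem setLIntegral_windowAverage_of_periodic [MeasurableEq α]
    (hF : ∀ k : ℤ, MeasurePreserving ⇑(F ^ k) μ μ) (hp : Measurable p) (hf : Measurable f)
    (hp0 : ∀ z, p z ≠ 0) (hpt : ∀ z, p z ≠ ∞) {K n : ℕ} (hn : n ∈ Finset.Icc 1 K) (a : ℕ) :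
    ∫⁻ z in minimalPeriodSet F n, p z * windowAverage F p f K a z ∂μ =
      ∫⁻ z in minimalPeriodSet F n, p z * f z ∂μ := by
  have hFm : ∀ k : ℤ, Measurable ⇑(F ^ k) := fun k => (hF k).measurable
  have hn1 : 1 ≤ n := (Finset.mem_Icc.1 hn).1
  set D := minimalPeriodSet F n
  have hD : MeasurableSet D := measurableSet_minimalPeriodSet hFm n
  set S : (α → ℝ≥0∞) → α → ℝ≥0∞ := fun g z => ∑ b ∈ Finset.range n, g ((F ^ (b : ℤ)) z)
  have hS : ∀ {g : α → ℝ≥0∞}, Measurable g → Measurable (S g) := fun hg =>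
    Finset.measurable_fun_sum _ fun b _ => hg.comp (hFm _)
  have hS0 : ∀ z, S p z ≠ 0 := fun z h =>
    hp0 _ ((Finset.sum_eq_zero_iff.1 h) 0 (by simp; omega))
  have hSt : ∀ z, S p z ≠ ∞ := fun z => ENNReal.sum_ne_top.2 fun b _ => hpt _
  have hSinv : ∀ (g : α → ℝ≥0∞), ∀ z ∈ D, ∀ i : ℕ, S g ((F ^ (i : ℤ)) z) = S g z :=
    fun g z hz i => sum_period_comp hz.1 i g
  -- A factor constant along cycles passes through the average of `g` over the `n` translates.
  have hmean : ∀ {g w : α → ℝ≥0∞}, Measurable g → Measurable w →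
      (∀ z ∈ D, ∀ i : ℕ, w ((F ^ (i : ℤ)) z) = w z) →
      n * ∫⁻ z in D, g z * w z ∂μ = ∫⁻ z in D, S g z * w z ∂μ := by
    intro g w hg hw hinv
    have : ∀ z ∈ D, S g z * w z = ∑ i ∈ Finset.range n,
        (fun z => g z * w z) ((F ^ (i : ℤ)) z) := fun z hz => by
      simp only [S, Finset.sum_mul, hinv z hz]
    rw [setLIntegral_congr_fun hD this,
      lintegral_finsetSum (f := fun (i : ℕ) z => (fun z => g z * w z) ((F ^ (i : ℤ)) z)) _
        fun i _ => (hg.mul hw).comp (hFm i)]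
    rw [Finset.sum_congr rfl fun (i : ℕ) _ =>
      setLIntegral_comp_zpow (g := fun z => g z * w z) hF hD (zpow_mem_minimalPeriodSet_iff n)
        (i : ℤ) (hg.mul hw)]
    simp
  have h1 : ∀ z ∈ D, p z * windowAverage F p f K a z =
      p z * (S (fun y => p y * f y) z / S p z) := fun z hz => by
    rw [windowAverage, sum_orbitWindow_of_periodic hn hz, sum_orbitWindow_of_periodic hn hz]
    simp only [S, div_eq_mul_inv, Finset.sum_mul]
    congr 1
    exact Finset.sum_congr rfl fun b _ => by ring
  have hn0 : (n : ℝ≥0∞) ≠ 0 := by exact_mod_cast (by omega : n ≠ 0)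
  -- After multiplication by `n`, the factor `p` becomes its cycle sum, which cancels the
  -- denominator.
  rw [setLIntegral_congr_fun hD h1, ← ENNReal.mul_right_inj hn0 (ENNReal.natCast_ne_top n),
    hmean (w := fun z => S (fun y => p y * f y) z / S p z) hp
      ((hS (hp.mul hf)).div (hS hp)) fun z hz i => by
      rw [hSinv p z hz, hSinv (fun y => p y * f y) z hz]]
  have h2 := hmean (g := fun y => p y * f y) (w := fun _ => 1) (hp.mul hf) measurable_const
    fun _ _ _ => rfl
  simp only [mul_one] at h2
  rw [h2]
  exact lintegral_congr fun z => ENNReal.mul_div_cancel (hS0 z) (hSt z)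

/-- Averaging over a uniformly positioned window of the orbit of a measure preserving permutation
leaves the measure with density `p` invariant. -/
theorem sum_lintegral_windowAverage [MeasurableEq α]
    (hF : ∀ k : ℤ, MeasurePreserving ⇑(F ^ k) μ μ) (hp : Measurable p) (hf : Measurable f)
    (hp0 : ∀ z, p z ≠ 0) (hpt : ∀ z, p z ≠ ∞) (K : ℕ) :
    ∑ a ∈ Finset.range (K + 1), ∫⁻ z, p z * windowAverage F p f K a z ∂μ =
      (K + 1) * ∫⁻ z, p z * f z ∂μ := by
  have hFm : ∀ k : ℤ, Measurable ⇑(F ^ k) := fun k => (hF k).measurable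
  have hsplit : ∀ g : α → ℝ≥0∞, ∫⁻ z, g z ∂μ = ∫⁻ z in nonreturningSet F K, g z ∂μ +
      ∑ n ∈ Finset.Icc 1 K, ∫⁻ z in minimalPeriodSet F n, g z ∂μ := fun g => by
    rw [← lintegral_add_compl g (measurableSet_nonreturningSet hFm K), compl_nonreturningSet,
      lintegral_biUnion_finset (pairwiseDisjoint_minimalPeriodSet K)
        fun n _ => measurableSet_minimalPeriodSet hFm n]
  simp_rw [hsplit]
  rw [Finset.sum_add_distrib, sum_setLIntegral_windowAverage_of_nonreturning hF hp hf hp0 hpt,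
    mul_add]
  congr 1
  have : ∀ a, ∑ n ∈ Finset.Icc 1 K,
      ∫⁻ z in minimalPeriodSet F n, p z * windowAverage F p f K a z ∂μ =
      ∑ n ∈ Finset.Icc 1 K, ∫⁻ z in minimalPeriodSet F n, p z * f z ∂μ := fun a =>
    Finset.sum_congr rfl fun n hn =>
      setLIntegral_windowAverage_of_periodic hF hp hf hp0 hpt hn a
  simp [this]

end OrbitWindows

/-! ### Leap-frog dynamics and invariance of the target -/

namespace HMCInput

variable {d : ℕ} (H : HMCInput d)

/-- The change of the momentum in a half step. -/
theorem measurePreserving_kick : MeasurePreserving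
    (fun z : Phase d => (z.1, z.2 + (H.ε / 2) • H.score z.1)) volume volume := by
  have hs := H.measurable_score
  exact (MeasurePreserving.id volume).skew_product
    (g := fun θ p => p + (H.ε / 2) • H.score θ) (by fun_prop)
    (ae_of_all _ fun θ => (measurePreserving_add_right volume ((H.ε / 2) • H.score θ)).map_eq)

/-- The change of the position in a step. -/
theorem measurePreserving_drift : MeasurePreserving
    (fun z : Phase d => (z.1 + H.ε • H.velocity z.2, z.2)) volume volume := by
  have hv := H.measurable_velocity
  have h := (MeasurePreserving.id volume).skew_product (μc := volume) (μd := volume)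
    (g := fun (p θ : EuclideanSpace ℝ (Fin d)) => θ + H.ε • H.velocity p) (by fun_prop)
    (ae_of_all _ fun p => (measurePreserving_add_right volume (H.ε • H.velocity p)).map_eq)
  -- The shear acts on the second coordinate, so the two coordinates are swapped before and after
  -- it.
  exact (Measure.measurePreserving_swap.comp h).comp Measure.measurePreserving_swap

/-- Kick, drift and kick each translate one coordinate by a measurable function of the other; no
derivative of the score enters. -/
theorem measurePreserving_leapfrog : MeasurePreserving ⇑H.leapfrog volume volume :=
  H.measurePreserving_kick.comp (H.measurePreserving_drift.comp H.measurePreserving_kick)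

theorem measurePreserving_leapfrog_zpow (k : ℤ) :
    MeasurePreserving ⇑(H.leapfrog ^ k) volume volume := by
  have hback : MeasurePreserving ⇑(H.leapfrog⁻¹) volume volume := by
    let e : Phase d ≃ᵐ Phase d := ⟨H.leapfrog, by simpa using H.measurable_leapfrog_zpow 1,
      by simpa using H.measurable_leapfrog_zpow (-1)⟩
    exact MeasurePreserving.symm e H.measurePreserving_leapfrog
  induction k with
  | zero => simpa using MeasurePreserving.id _
  | succ n ih =>
    rw [zpow_add_one, Equiv.Perm.coe_mul]
    exact ih.comp H.measurePreserving_leapfrog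
  | pred n ih =>
    rw [zpow_sub_one, Equiv.Perm.coe_mul]
    exact ih.comp hback

end HMCInput

/-- The reversal of the momentum. -/
def momentumFlip (d : ℕ) : Equiv.Perm (Phase d) where
  toFun z := (z.1, -z.2)
  invFun z := (z.1, -z.2)
  left_inv z := by simp
  right_inv z := by simp

theorem measurePreserving_momentumFlip (d : ℕ) :
    MeasurePreserving ⇑(momentumFlip d) volume volume :=
  (MeasurePreserving.id volume).prod (Measure.measurePreserving_neg volume)

namespace HMCInput

variable {d : ℕ} (H : HMCInput d)

theorem density_momentumFlip (z : Phase d) : H.density (momentumFlip d z) = H.density z := by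
  simp [density, momentumFlip, gaussianDensity, Matrix.mulVec_neg]

theorem velocity_neg (p : EuclideanSpace ℝ (Fin d)) : H.velocity (-p) = -H.velocity p := by
  simp [velocity, Matrix.mulVec_neg]

/-- The leap-frog map is reversible. -/
theorem momentumFlip_conj_leapfrog :
    momentumFlip d * H.leapfrog * (momentumFlip d)⁻¹ = H.leapfrog⁻¹ := by
  ext1 z
  change momentumFlip d (H.leapfrogStep (momentumFlip d z)) = H.leapfrogBack z
  have h : -z.2 + (H.ε / 2) • H.score z.1 = -(z.2 - (H.ε / 2) • H.score z.1) := by abel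
  simp only [momentumFlip, Equiv.coe_fn_mk, leapfrogStep, leapfrogBack, h, velocity_neg, smul_neg,
    ← sub_eq_add_neg]
  refine Prod.ext rfl ?_
  simp only
  abel

/-- The leap-frog proposal followed by a reversal of the momentum. -/
def flippedProposal (ℓ : ℤ) (z : Phase d) : Phase d := momentumFlip d ((H.leapfrog ^ ℓ) z)

/-- Conjugation by the flip inverts the leap-frog map, hence inverts each of its powers. -/
theorem flippedProposal_involutive (ℓ : ℤ) : Function.Involutive (H.flippedProposal ℓ) := by
  intro z
  have h := congrArg (fun e : Equiv.Perm (Phase d) => e ^ ℓ) H.momentumFlip_conj_leapfrog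
  simp only [conj_zpow, inv_zpow] at h
  have h' := DFunLike.congr_fun h ((H.leapfrog ^ ℓ) z)
  rw [← Equiv.Perm.mul_apply (H.leapfrog ^ ℓ)⁻¹, inv_mul_cancel] at h'
  exact h'

theorem measurePreserving_flippedProposal (ℓ : ℤ) :
    MeasurePreserving (H.flippedProposal ℓ) volume volume :=
  (measurePreserving_momentumFlip d).comp (H.measurePreserving_leapfrog_zpow ℓ)

/-- The density of the augmented target, with values in `ℝ≥0∞`. -/
def edensity (z : Phase d) : ℝ≥0∞ := ENNReal.ofReal (H.density z)

theorem measurable_edensity : Measurable H.edensity := H.measurable_density.ennreal_ofReal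

theorem edensity_ne_zero (z : Phase d) : H.edensity z ≠ 0 :=
  (ENNReal.ofReal_pos.2 (H.density_pos z)).ne'

theorem edensity_ne_top (z : Phase d) : H.edensity z ≠ ∞ := ENNReal.ofReal_ne_top

theorem coe_target : (H.target : Measure (Phase d)) = volume.withDensity H.edensity := rfl

theorem lintegral_target {g : Phase d → ℝ≥0∞} (hg : Measurable g) :
    ∫⁻ z, g z ∂(H.target : Measure (Phase d)) = ∫⁻ z, H.edensity z * g z := by
  rw [coe_target, lintegral_withDensity_eq_lintegral_mul _ H.measurable_edensity hg]
  rfl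

theorem target_eq_prod : (H.target : Measure (Phase d)) =
    (volume.withDensity fun θ => ENNReal.ofReal (H.pdf θ)).prod H.momentumLaw := by
  rw [momentumLaw, prod_withDensity H.measurable_pdf.ennreal_ofReal
    (continuous_gaussianDensity H.M).measurable.ennreal_ofReal, coe_target,
    ← Measure.volume_eq_prod]
  congr 1
  funext z
  rw [edensity, density, ENNReal.ofReal_mul (H.pdf_pos _).le]

theorem refreshLaw_apply (z : Phase d) {B : Set (Phase d)} (hB : MeasurableSet B) :
    H.refreshLaw z B = H.momentumLaw (Prod.mk z.1 ⁻¹' B) := by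
  rw [refreshLaw, Measure.dirac_prod, Measure.map_apply measurable_prodMk_left hB]

/-- Refreshing the momentum leaves the target invariant. -/
theorem lintegral_refreshLaw_target {B : Set (Phase d)} (hB : MeasurableSet B) :
    ∫⁻ z, H.refreshLaw z B ∂(H.target : Measure (Phase d)) = (H.target : Measure (Phase d)) B := by
  have hm := measurable_measure_prodMk_left (ν := H.momentumLaw) hB
  simp_rw [H.refreshLaw_apply _ hB]
  have hm' : Measurable fun z : Phase d => H.momentumLaw (Prod.mk z.1 ⁻¹' B) :=
    hm.comp measurable_fst
  rw [target_eq_prod, lintegral_prod _ hm'.aemeasurable, Measure.prod_apply hB]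
  simp

theorem measurable_refreshLaw_coe {B : Set (Phase d)} (hB : MeasurableSet B) :
    Measurable fun z => H.refreshLaw z B :=
  (Measure.measurable_coe hB).comp H.measurable_refreshLaw

/-- Detailed balance: the right-hand side is symmetric under the involution that exchanges the state
and its flipped proposal. -/
theorem edensity_mul_acceptProb (ℓ : ℤ) (z : Phase d) :
    H.edensity z * ENNReal.ofReal (H.acceptProb ℓ z) =
      min (H.edensity z) (H.edensity (H.flippedProposal ℓ z)) := by
  have h := H.density_pos z
  rw [edensity, edensity, ← ENNReal.ofReal_mul h.le, acceptProb, mul_min_of_nonneg _ _ h.le,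
    mul_one, mul_div_cancel₀ _ h.ne', ENNReal.ofReal_min, flippedProposal, density_momentumFlip]

/-- The Metropolis step followed by a refreshment of the momentum leaves the target invariant. -/
theorem lintegral_moveLaw_target (K L : ℕ) {B : Set (Phase d)} (hB : MeasurableSet B) :
    ∫⁻ z, H.moveLaw K L z B ∂(H.target : Measure (Phase d)) =
      (H.target : Measure (Phase d)) B := by
  set ℓ := jump K L
  set r : Phase d → ℝ≥0∞ := fun z => H.refreshLaw z B with hr
  have hrm : Measurable r := H.measurable_refreshLaw_coe hB
  have ha := H.measurable_acceptProb ℓ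
  have hp := H.measurable_edensity
  have hG := H.measurePreserving_flippedProposal ℓ
  have hGm := hG.measurable
  -- The refreshed law depends on the position alone, so the proposal may be replaced by its flip
  -- definitionally.
  have happ : ∀ z, H.moveLaw K L z B = ENNReal.ofReal (H.acceptProb ℓ z) * r (H.flippedProposal ℓ z)
      + ENNReal.ofReal (1 - H.acceptProb ℓ z) * r z := fun z => rfl
  -- Change of variables along the volume preserving involution: the flow of accepted mass into a
  -- set equals the flow out.
  have hswap : ∫⁻ z, H.edensity z * (ENNReal.ofReal (H.acceptProb ℓ z) * r (H.flippedProposal ℓ z))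
      = ∫⁻ z, H.edensity z * (ENNReal.ofReal (H.acceptProb ℓ z) * r z) := by
    simp_rw [← mul_assoc, edensity_mul_acceptProb]
    rw [← hG.lintegral_comp
      (f := fun z => min (H.edensity z) (H.edensity (H.flippedProposal ℓ z)) * r z) (by fun_prop)]
    simp_rw [H.flippedProposal_involutive ℓ _, min_comm]
  simp_rw [happ]
  rw [lintegral_target _ (by fun_prop), ← lintegral_refreshLaw_target H hB,
    lintegral_target _ hrm]
  simp_rw [mul_add]
  rw [lintegral_add_left (by fun_prop), hswap, ← lintegral_add_left (by fun_prop)]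
  refine lintegral_congr fun z => ?_
  have h0 := H.acceptProb_nonneg ℓ z
  have h1 : H.acceptProb ℓ z ≤ 1 := min_le_left _ _
  rw [← mul_add, ← add_mul, ← ENNReal.ofReal_add h0 (by linarith)]
  simp [hr]

theorem proposalSet_eq_orbitWindow {K L : ℕ} (z : Phase d) :
    H.proposalSet K L z = orbitWindow H.leapfrog K L z := by
  classical
  ext y
  simp only [proposalSet, orbitWindow, Finset.mem_image, Finset.mem_Icc, Finset.mem_range]
  constructor
  · rintro ⟨k, hk, rfl⟩
    exact ⟨(k + L).toNat, by omega, by rw [Int.toNat_of_nonneg (by omega), add_sub_cancel_right]⟩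
  · rintro ⟨b, hb, rfl⟩
    exact ⟨(b : ℤ) - L, by omega, rfl⟩

theorem selectLaw_apply (K L : ℕ) (z : Phase d) {B : Set (Phase d)} (hB : MeasurableSet B) :
    H.selectLaw K L z B = windowAverage H.leapfrog H.edensity (B.indicator 1) K L z := by
  have hs : 0 < ∑ y' ∈ H.proposalSet K L z, H.density y' :=
    Finset.sum_pos (fun y _ => H.density_pos y) (H.proposalSet_nonempty K L z)
  simp only [selectLaw, Measure.finsetSum_apply, Measure.smul_apply, smul_eq_mul,
    Measure.dirac_apply' _ hB, weight, windowAverage, ← proposalSet_eq_orbitWindow, edensity]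
  refine Finset.sum_congr rfl fun y _ => ?_
  rw [ENNReal.ofReal_div_of_pos hs, ENNReal.ofReal_sum_of_nonneg fun y _ => (H.density_pos y).le]

theorem measurable_selectLaw_coe (K L : ℕ) {B : Set (Phase d)} (hB : MeasurableSet B) :
    Measurable fun z => H.selectLaw K L z B :=
  (Measure.measurable_coe hB).comp (H.measurable_selectLaw K L)

/-- The recycled states have law `π` when the current state has law `π`. -/
theorem sum_lintegral_selectLaw_target (K : ℕ) {B : Set (Phase d)} (hB : MeasurableSet B) :
    ∑ L ∈ Finset.range (K + 1), ∫⁻ z, H.selectLaw K L z B ∂(H.target : Measure (Phase d)) =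
      (K + 1) * (H.target : Measure (Phase d)) B := by
  have h := sum_lintegral_windowAverage (f := B.indicator 1) H.measurePreserving_leapfrog_zpow
    H.measurable_edensity (measurable_one.indicator hB) H.edensity_ne_zero H.edensity_ne_top K
  rw [← lintegral_target H (measurable_one.indicator hB), lintegral_indicator_one hB] at h
  rw [← h]
  refine Finset.sum_congr rfl fun L _ => ?_
  rw [lintegral_target H (H.measurable_selectLaw_coe K L hB)]
  exact lintegral_congr fun z => by rw [selectLaw_apply H K L z hB]

theorem add_one_inv_mul_cancel (K : ℕ) : ((K : ℝ≥0∞) + 1)⁻¹ * ((K : ℝ≥0∞) + 1) = 1 :=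
  ENNReal.inv_mul_cancel (by simp) (by finiteness)

theorem chainKernel_apply (K : ℕ) (z : Phase d) {B : Set (Phase d)} (hB : MeasurableSet B) :
    H.chainKernel K z B =
      ∑ L ∈ Finset.range (K + 1), ((K : ℝ≥0∞) + 1)⁻¹ * H.moveLaw K L z B := by
  rw [chainKernel, Kernel.fst_apply' _ _ hB]
  change H.stepLaw K z (Prod.fst ⁻¹' B) = _
  simp only [stepLaw, Measure.finsetSum_apply, Measure.smul_apply, smul_eq_mul]
  refine Finset.sum_congr rfl fun L _ => ?_
  rw [← Set.prod_univ, Measure.prod_prod, measure_univ, mul_one]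

theorem stepKernel_apply_recycled (K : ℕ) (k : Fin K) (z : Phase d) {B : Set (Phase d)}
    (hB : MeasurableSet B) : H.stepKernel K z ((fun q => q.2 k) ⁻¹' B) =
      ∑ L ∈ Finset.range (K + 1), ((K : ℝ≥0∞) + 1)⁻¹ * H.selectLaw K L z B := by
  change H.stepLaw K z ((fun q => q.2 k) ⁻¹' B) = _
  simp only [stepLaw, Measure.finsetSum_apply, Measure.smul_apply, smul_eq_mul]
  refine Finset.sum_congr rfl fun L _ => ?_
  have h : (fun q : Phase d × (Fin K → Phase d) => q.2 k) ⁻¹' B =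
      Set.univ ×ˢ (Function.eval k ⁻¹' B) := by ext q; simp
  rw [h, Measure.prod_prod, measure_univ, one_mul,
    (measurePreserving_eval (fun _ : Fin K => H.selectLaw K L z) k).measure_preimage
      hB.nullMeasurableSet]

theorem invariant_target (K : ℕ) :
    (H.chainKernel K).Invariant (H.target : Measure (Phase d)) := by
  change (H.target : Measure (Phase d)).bind (H.chainKernel K) = _
  ext B hB
  rw [Measure.bind_apply hB (Kernel.aemeasurable _)]
  simp_rw [H.chainKernel_apply K _ hB]
  have hm : ∀ L, Measurable fun z => H.moveLaw K L z B := fun L =>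
    (Measure.measurable_coe hB).comp (H.measurable_moveLaw K L)
  rw [lintegral_finsetSum _ fun L _ => (hm L).const_mul _]
  simp_rw [lintegral_const_mul _ (hm _), H.lintegral_moveLaw_target K _ hB]
  rw [Finset.sum_const, Finset.card_range, nsmul_eq_mul, ← mul_assoc, Nat.cast_succ, mul_comm _ (_⁻¹),
    add_one_inv_mul_cancel, one_mul]

/-! ### The stationary chain of vectors -/

/-- The stationary law of the vector of states. -/
def stationaryLaw (K : ℕ) : Measure (Phase d × (Fin K → Phase d)) :=
  H.stepKernel K ∘ₘ (H.target : Measure (Phase d))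

instance (K : ℕ) : IsProbabilityMeasure (H.stationaryLaw K) := by
  unfold stationaryLaw; infer_instance

theorem map_recycled_stationaryLaw (K : ℕ) (k : Fin K) :
    (H.stationaryLaw K).map (fun q => q.2 k) = (H.target : Measure (Phase d)) := by
  ext B hB
  have hk : Measurable fun q : Phase d × (Fin K → Phase d) => q.2 k := by fun_prop
  rw [Measure.map_apply hk hB, stationaryLaw,
    Measure.bind_apply (hk hB) (Kernel.aemeasurable _)]
  simp_rw [H.stepKernel_apply_recycled K k _ hB]
  have hm : ∀ L, Measurable fun z => H.selectLaw K L z B := fun L =>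
    H.measurable_selectLaw_coe K L hB
  rw [lintegral_finsetSum _ fun L _ => (hm L).const_mul _]
  simp_rw [lintegral_const_mul _ (hm _)]
  rw [← Finset.mul_sum, H.sum_lintegral_selectLaw_target K hB, ← mul_assoc,
    add_one_inv_mul_cancel, one_mul]

/-- The transition kernel of the chain of the vectors of states. -/
def vectorKernel (K : ℕ) : Kernel (Phase d × (Fin K → Phase d)) (Phase d × (Fin K → Phase d)) :=
  (H.stepKernel K).comap Prod.fst measurable_fst

instance (K : ℕ) : IsMarkovKernel (H.vectorKernel K) := by unfold vectorKernel; infer_instance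

theorem vectorKernel_comp (K : ℕ) (μ : Measure (Phase d × (Fin K → Phase d))) :
    H.vectorKernel K ∘ₘ μ = H.stepKernel K ∘ₘ μ.map Prod.fst := by
  ext s hs
  rw [Measure.bind_apply hs (Kernel.aemeasurable _), Measure.bind_apply hs (Kernel.aemeasurable _),
    lintegral_map (Kernel.measurable_coe _ hs) measurable_fst]
  rfl

theorem map_fst_stepKernel_comp (K : ℕ) (μ : Measure (Phase d)) :
    (H.stepKernel K ∘ₘ μ).map Prod.fst = H.chainKernel K ∘ₘ μ := by
  rw [Measure.map_comp _ _ measurable_fst, chainKernel, Kernel.fst_eq]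

theorem invariant_stationaryLaw (K : ℕ) : (H.vectorKernel K).Invariant (H.stationaryLaw K) := by
  change H.vectorKernel K ∘ₘ H.stationaryLaw K = _
  rw [vectorKernel_comp, stationaryLaw, map_fst_stepKernel_comp, (H.invariant_target K).def]

/-- A stationary law of vectors is one algorithm step applied to its chain marginal, and this
marginal is stationary for `P₀`, hence is the target. -/
theorem eq_stationaryLaw_of_invariant {K : ℕ} (hu : UniquelyErgodic (H.chainKernel K))
    {ν : Measure (Phase d × (Fin K → Phase d))} [IsProbabilityMeasure ν]
    (hν : (H.vectorKernel K).Invariant ν) : ν = H.stationaryLaw K := by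
  have h1 : H.stepKernel K ∘ₘ ν.map Prod.fst = ν := by rw [← vectorKernel_comp]; exact hν
  have hp : IsProbabilityMeasure (ν.map Prod.fst) :=
    Measure.isProbabilityMeasure_map measurable_fst.aemeasurable
  have hi : (H.chainKernel K).Invariant (ν.map Prod.fst) := by
    change H.chainKernel K ∘ₘ ν.map Prod.fst = _
    rw [← map_fst_stepKernel_comp, h1]
  have h2 := hu.unique (y₁ := ⟨ν.map Prod.fst, hp⟩) (y₂ := H.target) hi (H.invariant_target K)
  have h3 : ν.map Prod.fst = (H.target : Measure (Phase d)) :=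
    congrArg (fun m : ProbabilityMeasure (Phase d) => (m : Measure (Phase d))) h2
  rw [← h1, h3, stationaryLaw]

end HMCInput

/-! ### Weak convergence of the empirical measures -/

/-- A second countable space has a countable `π`-system of open sets which contains arbitrarily
small neighbourhoods of each point. -/
theorem exists_countable_isPiSystem_nhds (X : Type*) [TopologicalSpace X]
    [SecondCountableTopology X] : ∃ S : Set (Set X), S.Countable ∧ IsPiSystem S ∧
      (∀ s ∈ S, IsOpen s) ∧ ∀ u : Set X, IsOpen u → ∀ x ∈ u, ∃ s ∈ S, s ∈ 𝓝 x ∧ s ⊆ u := by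
  have hB := TopologicalSpace.isBasis_countableBasis X
  -- The finite intersections of sets of a countable basis.
  refine ⟨Set.sInter '' {T | T.Finite ∧ T ⊆ TopologicalSpace.countableBasis X}, ?_, ?_, ?_, ?_⟩
  · exact (Set.countable_ofPred_finite_subset (TopologicalSpace.countable_countableBasis X)).image _
  · rintro _ ⟨T, hT, rfl⟩ _ ⟨T', hT', rfl⟩ -
    exact ⟨T ∪ T', ⟨hT.1.union hT'.1, Set.union_subset hT.2 hT'.2⟩, Set.sInter_union T T'⟩
  · rintro _ ⟨T, hT, rfl⟩
    exact hT.1.isOpen_sInter fun t ht => hB.isOpen (hT.2 ht)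
  · intro u hu x hx
    obtain ⟨v, hv, hxv, hvu⟩ := hB.exists_subset_of_mem_open hx hu
    exact ⟨v, ⟨{v}, ⟨Set.finite_singleton v, by simpa using hv⟩, Set.sInter_singleton v⟩,
      (hB.isOpen hv).mem_nhds hxv, hvu⟩

/-- Prepending a term does not change the limit of the averages of a sequence. -/
theorem tendsto_average_succ {u : ℕ → ℝ} {c : ℝ}
    (h : Tendsto (fun n : ℕ => (n : ℝ)⁻¹ * ∑ i ∈ Finset.range n, u (i + 1)) atTop (𝓝 c)) :
    Tendsto (fun n : ℕ => ((n + 1 : ℕ) : ℝ)⁻¹ * ∑ i ∈ Finset.range (n + 1), u i) atTop (𝓝 c) := by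
  have h1 := (tendsto_natCast_div_add_atTop (1 : ℝ)).mul h
  have h2 : Tendsto (fun n : ℕ => ((n : ℝ) + 1)⁻¹ * u 0) atTop (𝓝 0) := by
    simpa using (tendsto_one_div_add_atTop_nhds_zero_nat (𝕜 := ℝ)).mul_const (u 0)
  have h3 := h1.add h2
  rw [one_mul, add_zero] at h3
  refine h3.congr' ?_
  filter_upwards [eventually_ne_atTop 0] with n hn
  have hn' : (n : ℝ) ≠ 0 := by exact_mod_cast hn
  rw [Finset.sum_range_succ']
  push_cast
  field_simp

/-- The fraction of the recycled states which lie in a set. -/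
def recycledFraction {d K : ℕ} (s : Set (Phase d)) (q : Phase d × (Fin K → Phase d)) : ℝ :=
  (K : ℝ)⁻¹ * ∑ k : Fin K, s.indicator 1 (q.2 k)

theorem measurable_recycledFraction {d K : ℕ} {s : Set (Phase d)} (hs : MeasurableSet s) :
    Measurable (recycledFraction (K := K) s) := by
  have : Measurable (s.indicator (1 : Phase d → ℝ)) := measurable_one.indicator hs
  unfold recycledFraction
  fun_prop

theorem recycledEmpiricalMeasure_apply {d K : ℕ} (z : ℕ → Phase d × (Fin K → Phase d)) (N : ℕ)
    {s : Set (Phase d)} (hs : MeasurableSet s) :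
    (recycledEmpiricalMeasure z N : Measure (Phase d)).real s =
      (N : ℝ)⁻¹ * ∑ i ∈ Finset.range N, recycledFraction s (z i) := by
  have hd : ∀ y : Phase d, (Measure.dirac y).real s = s.indicator 1 y := fun y => by
    rw [Measure.real, Measure.dirac_apply' _ hs]
    by_cases hy : y ∈ s <;> simp [hy]
  have hcoe : (recycledEmpiricalMeasure z N : Measure (Phase d)) =
      ((N : ℝ≥0) * (K : ℝ≥0))⁻¹ • ∑ i ∈ Finset.range N, ∑ k : Fin K, Measure.dirac ((z i).2 k) := by
    rw [recycledEmpiricalMeasure, FiniteMeasure.toMeasure_smul, FiniteMeasure.toMeasure_sum]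
    simp_rw [FiniteMeasure.toMeasure_sum]
    rfl
  have hsum : (∑ i ∈ Finset.range N, ∑ k : Fin K, Measure.dirac ((z i).2 k)).real s =
      ∑ i ∈ Finset.range N, ∑ k : Fin K, s.indicator 1 ((z i).2 k) := by
    rw [Measure.real]
    simp only [Measure.finsetSum_apply]
    rw [ENNReal.toReal_sum fun i _ => ENNReal.sum_ne_top.2 fun k _ => measure_ne_top _ _]
    refine Finset.sum_congr rfl fun i _ => ?_
    rw [ENNReal.toReal_sum fun k _ => measure_ne_top _ _]
    exact Finset.sum_congr rfl fun k _ => hd _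
  rw [hcoe, measureReal_nnreal_smul_apply, hsum]
  simp only [recycledFraction]
  rw [← Finset.mul_sum, ← mul_assoc]
  push_cast
  rw [mul_inv]

theorem isProbabilityMeasure_recycledEmpiricalMeasure {d K : ℕ} (hK : 1 ≤ K)
    (z : ℕ → Phase d × (Fin K → Phase d)) (N : ℕ) :
    IsProbabilityMeasure (recycledEmpiricalMeasure z (N + 1) : Measure (Phase d)) := by
  have hK' : (K : ℝ) ≠ 0 := by exact_mod_cast (by omega : K ≠ 0)
  have hN : ((N : ℝ) + 1) ≠ 0 := by positivity
  have h : (recycledEmpiricalMeasure z (N + 1) : Measure (Phase d)).real Set.univ = 1 := by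
    rw [recycledEmpiricalMeasure_apply z (N + 1) MeasurableSet.univ]
    simp [recycledFraction, hK', hN]
  exact ⟨by rw [← ofReal_measureReal, h, ENNReal.ofReal_one]⟩

/-- A criterion for the weak convergence of the empirical measures. -/
theorem tendsto_recycledEmpiricalMeasure {d K : ℕ} (hK : 1 ≤ K) {μ : ProbabilityMeasure (Phase d)}
    {S : Set (Set (Phase d))} (hS : IsPiSystem S) (hopen : ∀ s ∈ S, IsOpen s)
    (hnhds : ∀ u : Set (Phase d), IsOpen u → ∀ x ∈ u, ∃ s ∈ S, s ∈ 𝓝 x ∧ s ⊆ u)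
    {z : ℕ → Phase d × (Fin K → Phase d)}
    (h : ∀ s ∈ S, Tendsto (fun n : ℕ => (n : ℝ)⁻¹ *
      ∑ i ∈ Finset.range n, recycledFraction s (z (i + 1))) atTop
        (𝓝 ((μ : Measure (Phase d)).real s))) :
    Tendsto (recycledEmpiricalMeasure z) atTop (𝓝 μ.toFiniteMeasure) := by
  -- The index is shifted because the empirical measure of zero vectors is null and not a
  -- probability measure.
  let ν : ℕ → ProbabilityMeasure (Phase d) := fun N =>
    ⟨recycledEmpiricalMeasure z (N + 1), isProbabilityMeasure_recycledEmpiricalMeasure hK z N⟩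
  have hν : Tendsto ν atTop (𝓝 μ) := by
    refine hS.tendsto_probabilityMeasure_of_tendsto_of_mem (fun s hs => (hopen s hs).measurableSet)
      hnhds fun s hs => ?_
    rw [← NNReal.tendsto_coe]
    refine (tendsto_average_succ (u := fun i => recycledFraction s (z i)) (h s hs)).congr fun N => ?_
    exact (recycledEmpiricalMeasure_apply z (N + 1) (hopen s hs).measurableSet).symm
  rw [ProbabilityMeasure.tendsto_nhds_iff_toFiniteMeasure_tendsto_nhds] at hν
  exact (tendsto_add_atTop_iff_nat 1).1 hν

namespace HMCInput

variable {d : ℕ} (H : HMCInput d)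

theorem integrable_indicator_recycled {K : ℕ} (k : Fin K) {s : Set (Phase d)}
    (hs : MeasurableSet s) : Integrable (fun q : Phase d × (Fin K → Phase d) =>
      s.indicator (1 : Phase d → ℝ) (q.2 k)) (H.stationaryLaw K) := by
  refine Integrable.of_bound ((measurable_one.indicator hs).comp
    ((measurable_pi_apply k).comp measurable_snd)).aestronglyMeasurable 1 (ae_of_all _ fun q => ?_)
  by_cases hq : q.2 k ∈ s <;> simp [hq]

theorem integrable_recycledFraction (K : ℕ) {s : Set (Phase d)} (hs : MeasurableSet s) :
    Integrable (recycledFraction (K := K) s) (H.stationaryLaw K) :=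
  (integrable_finsetSum _ fun k _ => H.integrable_indicator_recycled k hs).const_mul _

theorem integral_recycledFraction {K : ℕ} (hK : 1 ≤ K) {s : Set (Phase d)} (hs : MeasurableSet s) :
    ∫ q, recycledFraction s q ∂H.stationaryLaw K = (H.target : Measure (Phase d)).real s := by
  have hm : Measurable (s.indicator (1 : Phase d → ℝ)) := measurable_one.indicator hs
  have hK' : (K : ℝ) ≠ 0 := by exact_mod_cast (by omega : K ≠ 0)
  have hk : ∀ k : Fin K, ∫ q, s.indicator (1 : Phase d → ℝ) (q.2 k) ∂H.stationaryLaw K =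
      (H.target : Measure (Phase d)).real s := fun k => by
    rw [← H.map_recycled_stationaryLaw K k,
      ← integral_map (φ := fun q : Phase d × (Fin K → Phase d) => q.2 k) (by fun_prop)
      hm.aestronglyMeasurable, integral_indicator_one hs]
  unfold recycledFraction
  rw [integral_const_mul, integral_finsetSum _ fun k _ => H.integrable_indicator_recycled k hs]
  simp [hk, hK']

end HMCInput

/-! ### The path law of the algorithm -/

section PathLaw

variable {d K : ℕ} {H : HMCInput d} {Ω : Type*} [MeasurableSpace Ω] {P : Measure Ω}
  {Z : ℕ → Ω → Phase d × (Fin K → Phase d)}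

theorem IsCalderheadBerntonChain.aemeasurable (hZ : IsCalderheadBerntonChain H K P Z) (i : ℕ) :
    AEMeasurable (Z i) P :=
  aemeasurable_pi_iff.1 (HasCondDistrib.aemeasurable_fst (hZ i)) (Fin.last i)

variable [IsProbabilityMeasure P]

theorem IsCalderheadBerntonChain.isMarkovPathLaw (hZ : IsCalderheadBerntonChain H K P Z) :
    IsMarkovPathLaw (H.vectorKernel K) (P.map fun ω i => Z i ω) := by
  have hm : AEMeasurable (fun ω i => Z i ω) P := aemeasurable_pi_iff.2 hZ.aemeasurable
  intro n
  let g : (Fin (n + 1) → Phase d × (Fin K → Phase d)) →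
      (Finset.Iic n → Phase d × (Fin K → Phase d)) :=
    fun h i => h ⟨i, Nat.lt_succ_of_le (Finset.mem_Iic.1 i.2)⟩
  have hg : Measurable g := by fun_prop
  have h1 : HasCondDistrib (Z (n + 1)) (fun ω (j : Fin (n + 1)) => Z j ω)
    ((historyKernel (H.vectorKernel K) n).comap g hg) P := hZ n
  have h2 := h1.comp_right.map_eq
  rw [AEMeasurable.map_map_of_aemeasurable (by fun_prop) hm,
    AEMeasurable.map_map_of_aemeasurable (by fun_prop) hm]
  exact h2

/-- The recycled states of the first vector are arbitrary, so absolute continuity can hold only from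
the second vector on, which is one algorithm step applied to the law of the initial chain state. -/
theorem IsCalderheadBerntonChain.map_one_absolutelyContinuous
    (hZ : IsCalderheadBerntonChain H K P Z)
    (hinit : P.map (fun ω => (Z 0 ω).1) ≪ (H.target : Measure (Phase d))) :
    ((P.map fun ω i => Z i ω).map pathShift).map (fun x => x 0) ≪ H.stationaryLaw K := by
  have hm : AEMeasurable (fun ω i => Z i ω) P := aemeasurable_pi_iff.2 hZ.aemeasurable
  have : IsProbabilityMeasure (P.map fun ω i => Z i ω) := Measure.isProbabilityMeasure_map hm
  have h1 : (pathKernel (H.vectorKernel K)).map (fun x => x 1) = H.vectorKernel K := by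
    ext1 w
    rw [Kernel.map_apply _ (by fun_prop), map_eval_one_pathKernel]
  have h2 : ((P.map fun ω i => Z i ω).map pathShift).map (fun x => x 0) =
      H.stepKernel K ∘ₘ P.map (fun ω => (Z 0 ω).1) := by
    rw [Measure.map_map (by fun_prop) measurable_pathShift]
    change (P.map fun ω i => Z i ω).map (fun x => x 1) = _
    rw [hZ.isMarkovPathLaw.eq_pathKernel_comp, Measure.map_comp _ _ (by fun_prop), h1,
      HMCInput.vectorKernel_comp, Measure.map_map measurable_fst (measurable_pi_apply 0),
      AEMeasurable.map_map_of_aemeasurable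
        (measurable_fst.comp (measurable_pi_apply 0)).aemeasurable hm]
    rfl
  rw [h2]
  exact hinit.comp_right _

end PathLaw

end

/-! ### Almost sure weak convergence -/

theorem mainTheorem5 {d : ℕ} (H : HMCInput d) (K : ℕ) (hK : 1 ≤ K)
    (hP₀ : UniquelyErgodic (H.chainKernel K))
    {Ω : Type*} [MeasurableSpace Ω] (P : Measure Ω) [IsProbabilityMeasure P]
    (Z : ℕ → Ω → Phase d × (Fin K → Phase d))
    (hZ : IsCalderheadBerntonChain H K P Z)
    (hinit : P.map (fun ω => (Z 0 ω).1) ≪ (H.target : Measure (Phase d))) :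
    ∀ᵐ ω ∂P, Tendsto (recycledEmpiricalMeasure fun i => Z i ω) atTop
      (𝓝 H.target.toFiniteMeasure) := by
  obtain ⟨S, hSc, hSπ, hSo, hSn⟩ := exists_countable_isPiSystem_nhds (Phase d)
  have hm : AEMeasurable (fun ω i => Z i ω) P := aemeasurable_pi_iff.2 hZ.aemeasurable
  have : IsProbabilityMeasure (P.map fun ω i => Z i ω) := Measure.isProbabilityMeasure_map hm
  have : IsProbabilityMeasure ((P.map fun ω i => Z i ω).map pathShift) :=
    Measure.isProbabilityMeasure_map measurable_pathShift.aemeasurable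
  have key : ∀ s ∈ S, ∀ᵐ ω ∂P, Tendsto (fun n : ℕ => (n : ℝ)⁻¹ *
      ∑ i ∈ Finset.range n, recycledFraction s (Z (i + 1) ω)) atTop
        (𝓝 ((H.target : Measure (Phase d)).real s)) := by
    intro s hs
    have hsm := (hSo s hs).measurableSet
    -- The law of large numbers is applied to the path without its first vector, whose law is not
    -- controlled; one term does not affect the averages.
    have h := ae_tendsto_average (H.invariant_stationaryLaw K)
      (fun ν _ hν => H.eq_stationaryLaw_of_invariant hP₀ hν) hZ.isMarkovPathLaw.pathShift
      (hZ.map_one_absolutelyContinuous hinit) (measurable_recycledFraction hsm)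
      (H.integrable_recycledFraction K hsm)
    rw [H.integral_recycledFraction hK hsm] at h
    exact ae_of_ae_map hm (ae_of_ae_map measurable_pathShift.aemeasurable h)
  -- Countability of `S` merges the exceptional null sets into one.
  filter_upwards [(ae_ball_iff hSc).2 key] with ω hω
  exact tendsto_recycledEmpiricalMeasure hK hSπ hSo hSn hω
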